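/- **Setting.** Let $V_b=\{1,\dots,n_b\}$ be the non-reference nodes, $V_r$ the reference nodes and $V=V_b\cup V_r$, $n=|V|$. For $i=1,\dots,N$ let $\mathcal G_i$ be an undirected graph on $V$ with a weight matrix $W_i\in\mathbb R^{n\times n}$ such that $(W_i)_{uu}>0$, $(W_i)_{uv}>0$ if $\{u,v\}$ is an edge of $\mathcal G_i$, and $(W_i)_{uv}=0$ otherwise (no symmetry is required). Let $D_i$ be the diagonal part of $W_i$, $N_i=W_i-D_i$, $M_i=\mathrm{diag}\big(\sum_{v\ne u}(W_i)_{uv}\big)_u$, let $D_{bi},N_{bi},M_{bi}$ be their principal submatrices on $V_b$, and let $A_{bi}$ be the block diagonal matrix whose $u$-th block ($u\in V_b$) is the row $((N_i)_{uv})_{v\in V,\,v\neq u}$. Put $$J_{bi}=(M_{bi}+D_{bi})^{-1}(N_{bi}+D_{bi}),\qquad B_{bi}=(M_{bi}+D_{bi})^{-1}A_{bi}.$$ Let $\theta(k)$, $k\ge 0$, be a homogeneous Markov chain on $\{1,\dots,N\}$, with any initial distribution, whose transition matrix $\mathcal P=(p_{ij})$ is ergodic (irreducible and aperiodic). Let the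 noise $\epsilon(k)=(\epsilon_{u,v}(k))_{u\in V_b,\,v\in V,\,v\ne u}$ be a square integrable, wide sense stationary sequence with $\mathbb E[\epsilon(k)]=\gamma$ and $\mathbb E[\epsilon(k)\epsilon(k)^T]=\Gamma$, independent of the chain. Fix $k_0\ge 0$ and consider the jump linear error system $$e(k+1)=J_{b\,\theta(k)}\,e(k)+B_{b\,\theta(k)}\,\epsilon(k),\qquad k\ge k_0,$$ where the initial condition $e(k_0)$ is a square integrable random vector such that, from time $k_0$ on, $\theta$ remains Markov with transition matrix $\mathcal P$ given $e(k_0)$ and the past of $\theta$ (for instance $e(k_0)$ independent of the chain). Write $\mu(k)=\mathbb E[e(k)]$ and $\mathbf Q(k)=\mathbb E[e(k)e(k)^T]$. The system is *mean square convergent* if $\mu(k)$ and $\mathbf Q(k)$ converge as $k\to\infty$ for every initial condition, to limits that do not depend on the initial condition. Define the block matrices (block row $i$, block column $j$) $$\mathcal C_b=[\,p_{ji}J_{bj}\,]\in\mathbb R^{Nn_b\times Nn_b},\qquad \mathcal D_b=[\,p_{ji}\,J_{bj}\otimes J_{bj}\,]\in\mathbb R^{Nn_b^2\times Nn_b^2},$$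 let $\rho$ denote the spectral radius, and let $\hat\varphi$ be the bijection that stacks the columns of $V_1$, then those of $V_2,\dots,V_N$, of an $N$-tuple $(V_1,\dots,V_N)$ of $n_b\times n_b$ matrices into one vector of $\mathbb R^{Nn_b^2}$. **Lemma.** The system is mean square convergent if and only if $\rho(\mathcal D_b)<1$. The chain has a unique stationary distribution $\pi$. When mean square convergence occurs, $I-\mathcal C_b$ and $I-\mathcal D_b$ are invertible and $\mu(k)\to\mu:=\sum_{i=1}^N q_i$, where $$[q_1^T,\dots,q_N^T]^T=q:=(I-\mathcal C_b)^{-1}\psi,\qquad \psi_j:=\sum_{i=1}^N p_{ij}\pi_i B_{bi}\gamma .$$ If moreover the noise is uncorrelated in time, i.e. $\mathbb E[\epsilon(k)\epsilon(l)^T]=\gamma\gamma^T$ for $k\ne l$, then $\mathbf Q(k)\to\mathbf Q:=\sum_{i=1}^N Q_i$, where $$(Q_1,\dots,Q_N):=\hat\varphi^{-1}\big((I-\mathcal D_b)^{-1}\hat\varphi(R(q))\big),$$ $$R_j(q):=\sum_{i=1}^N p_{ij}\big(\pi_i B_{bi}\Gamma B_{bi}^T+J_{bi}q_i\gamma^TB_{bi}^T+B_{bi}\gamma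 q_i^TJ_{bi}^T\big),$$ and $\mathbf Q$ is positive semidefinite. -/

import Mathlib

open MeasureTheory ProbabilityTheory Filter Topology
open scoped Matrix Kronecker

/-! ### Weighted measurement graphs and the matrices built from them -/

/-- The nodes: `nb` nodes that do not know their variable, and `nr` reference nodes. -/
abbrev Node (nb nr : ℕ) : Type := Fin nb ⊕ Fin nr

/-- An undirected measurement graph with its weight matrix `W`: the entry `W u v` is the positive
weight that node `u` gives to the data received from its neighbour `v`, `W u u > 0` is the weight
that `u` gives to its own estimate, and all other entries vanish.  No symmetry is imposed. -/
structure WeightedGraph (nb nr : ℕ) where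
  graph : SimpleGraph (Node nb nr)
  W : Matrix (Node nb nr) (Node nb nr) ℝ
  pos_of_adj : ∀ u v, graph.Adj u v → 0 < W u v
  pos_self : ∀ u, 0 < W u u
  eq_zero : ∀ u v, u ≠ v → ¬ graph.Adj u v → W u v = 0

/-- Index set of the stacked noise vector: pairs `(u, v)` with `u` a non-reference node and `v` any
node different from `u`. -/
abbrev NoiseIdx (nb nr : ℕ) : Type :=
  Σ u : Fin nb, {v : Node nb nr // v ≠ Sum.inl u}

namespace WeightedGraph

variable {nb nr : ℕ} (G : WeightedGraph nb nr)

/-- The diagonal part `D` of the weight matrix. -/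
def diagPart : Matrix (Node nb nr) (Node nb nr) ℝ :=
  Matrix.diagonal fun u => G.W u u

/-- The off-diagonal part `N = W - D`. -/
def offPart : Matrix (Node nb nr) (Node nb nr) ℝ :=
  G.W - G.diagPart

/-- The diagonal matrix `M` with entries `∑_{v ≠ u} W u v`. -/
def rowPart : Matrix (Node nb nr) (Node nb nr) ℝ :=
  Matrix.diagonal fun u => ∑ v ∈ Finset.univ.erase u, G.W u v

/-- Principal submatrix on the non-reference nodes. -/
def basis (A : Matrix (Node nb nr) (Node nb nr) ℝ) : Matrix (Fin nb) (Fin nb) ℝ :=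
  A.submatrix Sum.inl Sum.inl

/-- `J_b = (M_b + D_b)⁻¹ (N_b + D_b)`; the inverted matrix is diagonal with positive entries. -/
noncomputable def Jb : Matrix (Fin nb) (Fin nb) ℝ :=
  (basis G.rowPart + basis G.diagPart)⁻¹ * (basis G.offPart + basis G.diagPart)

/-- The block diagonal matrix `A_b` whose `u`-th block is the row of the `N u v`, `v ≠ u`. -/
def Ab : Matrix (Fin nb) (NoiseIdx nb nr) ℝ :=
  Matrix.of fun u s => if s.1 = u then G.offPart (Sum.inl u) s.2.1 else 0

/-- `B_b = (M_b + D_b)⁻¹ A_b`. -/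
noncomputable def Bb : Matrix (Fin nb) (NoiseIdx nb nr) ℝ :=
  (basis G.rowPart + basis G.diagPart)⁻¹ * G.Ab

end WeightedGraph

/-! ### Moments -/

section Moments

variable {Ω : Type*} [MeasurableSpace Ω] {ι κ : Type*}

/-- The mean `E[x]` of a random vector, entry by entry. -/
noncomputable def meanVec (Pr : Measure Ω) (x : Ω → ι → ℝ) : ι → ℝ :=
  fun i => ∫ ω, x ω i ∂Pr

/-- The matrix `E[x yᵀ]` of two random vectors, entry by entry. -/
noncomputable def crossCorr (Pr : Measure Ω) (x : Ω → ι → ℝ) (y : Ω → κ → ℝ) : Matrix ι κ ℝ :=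
  Matrix.of fun i j => ∫ ω, x ω i * y ω j ∂Pr

/-- A (vector valued, square integrable) wide sense stationary sequence with mean `γ` and
correlation matrix `Γ`: the mean is constant and `E[ε(k) ε(l)ᵀ]` depends only on `k - l`. -/
structure IsWideSenseStationary [Fintype ι] (Pr : Measure Ω) (ε : ℕ → Ω → ι → ℝ)
    (γ : ι → ℝ) (Γ : Matrix ι ι ℝ) : Prop where
  measurable : ∀ k, Measurable (ε k)
  memLp : ∀ k, MemLp (ε k) 2 Pr
  mean_eq : ∀ k, meanVec Pr (ε k) = γ
  corr_eq : ∀ k, crossCorr Pr (ε k) (ε k) = Γ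
  shift : ∀ k l m, crossCorr Pr (ε (k + m)) (ε (l + m)) = crossCorr Pr (ε k) (ε l)

/-- The values of the sequence at different times are uncorrelated (white noise with mean `γ`). -/
def IsWhite (Pr : Measure Ω) (ε : ℕ → Ω → ι → ℝ) (γ : ι → ℝ) : Prop :=
  ∀ k l, k ≠ l → crossCorr Pr (ε k) (ε l) = Matrix.vecMulVec γ γ

end Moments

/-! ### Markov chains -/

section Chains

variable {N : ℕ}

/-- Transition matrix of an ergodic finite chain: a stochastic matrix, some power of which has
only positive entries (equivalently, irreducible and aperiodic). -/
def IsErgodicTransition (P : Matrix (Fin N) (Fin N) ℝ) : Prop :=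
  P ∈ Matrix.rowStochastic ℝ (Fin N) ∧ P.IsPrimitive

/-- A probability vector with `π P = π`. -/
def IsStationaryDistribution (P : Matrix (Fin N) (Fin N) ℝ) (π : Fin N → ℝ) : Prop :=
  (∀ i, 0 ≤ π i) ∧ ∑ i, π i = 1 ∧ π ᵥ* P = π

variable {Ω : Type*} [MeasurableSpace Ω]

/-- `θ` is a homogeneous Markov chain with transition matrix `P` (`P i j` is the probability of
moving from `i` to `j`) and an arbitrary initial distribution. -/
structure IsMarkovChain (Pr : Measure Ω) (P : Matrix (Fin N) (Fin N) ℝ)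
    (θ : ℕ → Ω → Fin N) : Prop where
  measurable : ∀ k, Measurable (θ k)
  markov : ∀ (k : ℕ) (x : ℕ → Fin N),
    Pr {ω | ∀ l ≤ k + 1, θ l ω = x l} =
      Pr {ω | ∀ l ≤ k, θ l ω = x l} * ENNReal.ofReal (P (x k) (x (k + 1)))

/-- A square integrable initial condition `x` for time `k₀`: from time `k₀` on, `θ` keeps its
transition probabilities when `x` is known together with the past of `θ`.  This holds when `x` is
independent of `θ` (in particular when `x` is constant), and also when `x` is produced from such a
vector, the states of `θ` before `k₀`, and noise that is independent of `θ` and that vector. -/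
structure IsInitialCondition {ι : Type*} [Fintype ι] (Pr : Measure Ω)
    (P : Matrix (Fin N) (Fin N) ℝ) (θ : ℕ → Ω → Fin N) (k₀ : ℕ) (x : Ω → ι → ℝ) : Prop where
  measurable : Measurable x
  memLp : MemLp x 2 Pr
  markov : ∀ (S : Set (ι → ℝ)), MeasurableSet S → ∀ k ≥ k₀, ∀ s : ℕ → Fin N,
    Pr {ω | x ω ∈ S ∧ ∀ l ≤ k + 1, θ l ω = s l} =
      Pr {ω | x ω ∈ S ∧ ∀ l ≤ k, θ l ω = s l} * ENNReal.ofReal (P (s k) (s (k + 1)))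

end Chains

/-! ### The jump linear error system -/

section System

variable {nb nr N : ℕ} {Ω : Type*} [MeasurableSpace Ω]

/-- `e` solves `e(k+1) = J_{b θ(k)} e(k) + B_{b θ(k)} ε(k)` for `k ≥ k₀`, with an admissible initial
condition at time `k₀`. -/
structure IsErrorTrajectory (G : Fin N → WeightedGraph nb nr) (P : Matrix (Fin N) (Fin N) ℝ)
    (k₀ : ℕ) (Pr : Measure Ω) (θ : ℕ → Ω → Fin N) (ε : ℕ → Ω → NoiseIdx nb nr → ℝ)
    (e : ℕ → Ω → Fin nb → ℝ) : Prop where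
  initial : IsInitialCondition Pr P θ k₀ (e k₀)
  step : ∀ k ≥ k₀, ∀ ω,
    e (k + 1) ω = (G (θ k ω)).Jb *ᵥ e k ω + (G (θ k ω)).Bb *ᵥ ε k ω

/-- Mean square convergence: `E[e(k)]` and `E[e(k) e(k)ᵀ]` converge for every initial condition, to
limits that do not depend on the initial condition. -/
def MeanSquareConvergent (G : Fin N → WeightedGraph nb nr) (P : Matrix (Fin N) (Fin N) ℝ)
    (k₀ : ℕ) (Pr : Measure Ω) (θ : ℕ → Ω → Fin N) (ε : ℕ → Ω → NoiseIdx nb nr → ℝ) : Prop :=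
  ∃ (μ : Fin nb → ℝ) (Q : Matrix (Fin nb) (Fin nb) ℝ),
    ∀ e, IsErrorTrajectory G P k₀ Pr θ ε e →
      Tendsto (fun k => meanVec Pr (e k)) atTop (𝓝 μ) ∧
      Tendsto (fun k => crossCorr Pr (e k) (e k)) atTop (𝓝 Q)

end System

/-! ### The matrices `C_b`, `D_b` and the limit formulas -/

section Limits

variable {nb nr N : ℕ}

/-- `C_b = [p_{ji} J_{bj}]` (block row `i`, block column `j`). -/
noncomputable def calC (G : Fin N → WeightedGraph nb nr) (P : Matrix (Fin N) (Fin N) ℝ) :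
    Matrix (Fin N × Fin nb) (Fin N × Fin nb) ℝ :=
  Matrix.of fun a b => P b.1 a.1 * (G b.1).Jb a.2 b.2

/-- `D_b = [p_{ji} J_{bj} ⊗ J_{bj}]` (block row `i`, block column `j`). -/
noncomputable def calD (G : Fin N → WeightedGraph nb nr) (P : Matrix (Fin N) (Fin N) ℝ) :
    Matrix (Fin N × (Fin nb × Fin nb)) (Fin N × (Fin nb × Fin nb)) ℝ :=
  Matrix.of fun a b => P b.1 a.1 * ((G b.1).Jb ⊗ₖ (G b.1).Jb) a.2 b.2

/-- The spectral radius of a real square matrix: the largest modulus of a complex eigenvalue. -/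
noncomputable def rho {ι : Type*} [Fintype ι] [DecidableEq ι] (A : Matrix ι ι ℝ) : ENNReal :=
  spectralRadius ℂ (A.map (algebraMap ℝ ℂ))

/-- The stacking operator `φ̂`: stack the columns of each matrix (`Matrix.vec`), then the results;
it is a bijection. -/
def hatPhi (N nb : ℕ) :
    (Fin N → Matrix (Fin nb) (Fin nb) ℝ) ≃ (Fin N × (Fin nb × Fin nb) → ℝ) where
  toFun V := fun a => (V a.1).vec a.2
  invFun v := fun i => Matrix.of fun r c => v (i, (c, r))
  left_inv _ := rfl
  right_inv _ := rfl

variable (G : Fin N → WeightedGraph nb nr) (P : Matrix (Fin N) (Fin N) ℝ) (π : Fin N → ℝ)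
  (γ : NoiseIdx nb nr → ℝ) (Γ : Matrix (NoiseIdx nb nr) (NoiseIdx nb nr) ℝ)

/-- `ψ_j = ∑_i p_{ij} π_i B_{bi} γ`, stacked over `j`. -/
noncomputable def psi : Fin N × Fin nb → ℝ :=
  fun a => (∑ i, (P i a.1 * π i) • ((G i).Bb *ᵥ γ)) a.2

/-- The blocks `q_1, …, q_N` of `q = (I - C_b)⁻¹ ψ`. -/
noncomputable def qLim (i : Fin N) : Fin nb → ℝ :=
  fun u => ((1 - calC G P)⁻¹ *ᵥ psi G P π γ) (i, u)

/-- `R_j(q) = ∑_i p_{ij} (π_i B_{bi} Γ B_{bi}ᵀ + J_{bi} q_i γᵀ B_{bi}ᵀ + B_{bi} γ q_iᵀ J_{bi}ᵀ)`. -/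
noncomputable def Rmat (q : Fin N → Fin nb → ℝ) (j : Fin N) : Matrix (Fin nb) (Fin nb) ℝ :=
  ∑ i, P i j • (π i • ((G i).Bb * Γ * (G i).Bbᵀ)
    + (G i).Jb * Matrix.vecMulVec (q i) γ * (G i).Bbᵀ
    + (G i).Bb * Matrix.vecMulVec γ (q i) * (G i).Jbᵀ)

/-- `(Q_1, …, Q_N) = φ̂⁻¹ ((I - D_b)⁻¹ φ̂(R(q)))`. -/
noncomputable def QLim : Fin N → Matrix (Fin nb) (Fin nb) ℝ :=
  (hatPhi N nb).symm
    ((1 - calD G P)⁻¹ *ᵥ hatPhi N nb (Rmat G P π γ Γ (qLim G P π γ)))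

end Limits

/-!
The error is the sum of a homogeneous part, started from `e k₀`, and of the response `w` to the noise
from zero initial state. All moments are split by the current mode: `E[x yᵀ; θ n = j]` is `modeCorr`.
If `x` and `y` are known at time `n`, the Markov property moves such moments one step ahead by a
weighted sum over modes (`IsMarkovFor.setIntegral_succ`). For the homogeneous part the known
information is `e k₀` and the past of the chain; for `w` it is the whole noise sequence and the past
of the chain, which is legitimate because noise and chain are independent. No independence of
`e k₀` and the noise is available or needed: mixed terms are handled by the Cauchy-Schwarz inequality.

*Homogeneous part.* Its stacked second moments evolve by `calD` (`hatPhi_modeCorr_homogeneous`), so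
they vanish in the limit if `rho calD < 1`. Conversely, under mean square convergence the
trajectories started from the constant vectors `1`, `-1` and `0` show that the homogeneous response
to `1` vanishes in mean square. Although some modes may be impossible at time `k₀`, the matrices `Jb`
are nonnegative with positive diagonal, so the second moments become a positive vector as soon as
all modes have positive probability; the powers of the nonnegative matrix `calD` kill this vector,
and hence `rho calD < 1` (`rho_calD_lt_one_of_tendsto`).

*Noise response.* Second moments dominate first moments, whence `rho calC < 1`
(`rho_calC_lt_one`). The means of `w` obey an affine recursion with matrix `calC`, the second moments
one with matrix `calD` whose forcing contains `E[w(n) ε(n)ᵀ; θ n = j]`. For stationary noise these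
correlations are convolutions of powers of `calC` with the lag correlations and converge by
dominated convergence (`exists_tendsto_noiseCorr`); for noise uncorrelated in time they equal
`E[w(n); θ n = j] γᵀ` (`noiseCorr_eq_smul_of_isWhite`), which yields the explicit limit. The mode
probabilities converge to the stationary distribution by Doeblin's contraction argument.
-/

/-! ### Powers of a matrix and its spectral radius -/

section MatrixPowers

variable {ι : Type*} [Fintype ι] [DecidableEq ι]

section Gelfand

attribute [local instance] Matrix.linftyOpNormedRing Matrix.linftyOpNormedAlgebra

theorem Matrix.norm_apply_le_linftyOp (A : Matrix ι ι ℂ) (i j : ι) : ‖A i j‖ ≤ ‖A‖ := by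
  rw [Matrix.linfty_opNorm_def]
  have h1 : ‖A i j‖₊ ≤ ∑ k, ‖A i k‖₊ :=
    Finset.single_le_sum (f := fun k => ‖A i k‖₊) (fun _ _ => zero_le) (Finset.mem_univ j)
  have h2 := Finset.le_sup (f := fun i : ι => ∑ k, ‖A i k‖₊) (Finset.mem_univ i)
  exact_mod_cast h1.trans h2

theorem exists_abs_pow_apply_le_of_rho_lt_one {A : Matrix ι ι ℝ} (hA : rho A < 1) :
    ∃ C r : ℝ, 0 ≤ C ∧ 0 ≤ r ∧ r < 1 ∧ ∀ n i j, |(A ^ n) i j| ≤ C * r ^ n := by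
  set a : Matrix ι ι ℂ := A.map (algebraMap ℝ ℂ) with ha
  have hent : ∀ n i j, |(A ^ n) i j| ≤ ‖a ^ n‖ := by
    intro n i j
    have h : a ^ n = (A ^ n).map (algebraMap ℝ ℂ) :=
      (map_pow ((algebraMap ℝ ℂ).mapMatrix (m := ι)) A n).symm
    have := Matrix.norm_apply_le_linftyOp (a ^ n) i j
    rw [h] at this ⊢
    simpa using this
  obtain ⟨r, hr, hr1⟩ := ENNReal.lt_iff_exists_nnreal_btwn.1 hA
  have hr0 : 0 < r := by
    have := (zero_le (a := rho A)).trans_lt hr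
    exact_mod_cast this
  have hev := (spectrum.pow_nnnorm_pow_one_div_tendsto_nhds_spectralRadius a).eventually_lt_const hr
  obtain ⟨m, hm⟩ := eventually_atTop.1 hev
  have hlarge : ∀ n ≥ m + 1, ‖a ^ n‖ ≤ (r : ℝ) ^ n := by
    intro n hn
    have h1 := (hm n (by omega)).le
    have hn0 : (n : ℝ) ≠ 0 := by
      have : n ≠ 0 := by omega
      exact_mod_cast this
    have h2 := ENNReal.rpow_le_rpow h1 (Nat.cast_nonneg n : (0 : ℝ) ≤ n)
    rw [← ENNReal.rpow_mul, one_div, inv_mul_cancel₀ hn0, ENNReal.rpow_one,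
      ENNReal.rpow_natCast] at h2
    exact_mod_cast h2
  refine ⟨1 + ∑ n ∈ Finset.range (m + 1), ‖a ^ n‖ / (r : ℝ) ^ n, r, by positivity,
    r.coe_nonneg, by exact_mod_cast hr1, fun n i j => (hent n i j).trans ?_⟩
  have hrn : (0 : ℝ) < (r : ℝ) ^ n := by positivity
  have hS : 0 ≤ ∑ n ∈ Finset.range (m + 1), ‖a ^ n‖ / (r : ℝ) ^ n := by positivity
  by_cases hn : n < m + 1
  · have h := Finset.single_le_sum (f := fun n => ‖a ^ n‖ / (r : ℝ) ^ n)
      (fun k _ => by positivity) (Finset.mem_range.2 hn)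
    calc ‖a ^ n‖ = ‖a ^ n‖ / (r : ℝ) ^ n * (r : ℝ) ^ n := by field_simp
      _ ≤ _ := by gcongr; linarith
  · calc ‖a ^ n‖ ≤ 1 * (r : ℝ) ^ n := by simpa using hlarge n (by omega)
      _ ≤ _ := by gcongr; linarith

theorem rho_lt_one_of_tendsto_pow {A : Matrix ι ι ℝ}
    (hA : ∀ i j, Tendsto (fun n => (A ^ n) i j) atTop (𝓝 0)) : rho A < 1 := by
  set a : Matrix ι ι ℂ := A.map (algebraMap ℝ ℂ) with ha
  have hsum : Tendsto (fun n => ∑ i, ∑ j, |(A ^ n) i j|) atTop (𝓝 0) := by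
    have := tendsto_finsetSum (Finset.univ : Finset ι) fun i _ =>
      tendsto_finsetSum (Finset.univ : Finset ι) fun j _ => (hA i j).abs
    simpa using this
  obtain ⟨n, hn1, hn⟩ := ((hsum.eventually_lt_const one_pos).and (eventually_ge_atTop 1)).exists
  cases isEmpty_or_nonempty ι
  · have : rho A = 0 := by
      rw [rho, spectralRadius]
      simp
    simp [this]
  have hnorm : ‖a ^ n‖ < 1 := by
    refine lt_of_le_of_lt ?_ hn1
    have h : a ^ n = (A ^ n).map (algebraMap ℝ ℂ) :=
      (map_pow ((algebraMap ℝ ℂ).mapMatrix (m := ι)) A n).symm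
    rw [h, Matrix.linfty_opNorm_def]
    have hle : (Finset.univ.sup fun i : ι => ∑ j, ‖(A ^ n).map (algebraMap ℝ ℂ) i j‖₊) ≤
        ∑ i : ι, ∑ j, ‖(A ^ n).map (algebraMap ℝ ℂ) i j‖₊ :=
      Finset.sup_le fun i hi => Finset.single_le_sum
        (f := fun i => ∑ j, ‖(A ^ n).map (algebraMap ℝ ℂ) i j‖₊) (fun _ _ => zero_le) hi
    have := NNReal.coe_le_coe.2 hle
    simpa using this
  have hnn : (rho A) ^ n < 1 := by
    calc (rho A) ^ n ≤ spectralRadius ℂ (a ^ n) := spectrum.spectralRadius_pow_le a n (by omega)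
      _ ≤ ‖a ^ n‖₊ := spectrum.spectralRadius_le_nnnorm _
      _ < 1 := by exact_mod_cast hnorm
  by_contra hge
  exact absurd (one_le_pow₀ (not_lt.1 hge)) (not_le.2 hnn)

end Gelfand

theorem tendsto_pow_apply_of_rho_lt_one {A : Matrix ι ι ℝ} (hA : rho A < 1) (i j : ι) :
    Tendsto (fun n => (A ^ n) i j) atTop (𝓝 0) := by
  obtain ⟨C, r, -, hr0, hr1, h⟩ := exists_abs_pow_apply_le_of_rho_lt_one hA
  refine squeeze_zero_norm (fun n => h n i j) ?_
  simpa using (tendsto_pow_atTop_nhds_zero_of_lt_one hr0 hr1).const_mul C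

theorem tendsto_pow_mulVec_of_rho_lt_one {A : Matrix ι ι ℝ} (hA : rho A < 1) (x : ι → ℝ) :
    Tendsto (fun n => A ^ n *ᵥ x) atTop (𝓝 0) := by
  refine tendsto_pi_nhds.2 fun i => ?_
  have := tendsto_finsetSum (Finset.univ : Finset ι) fun j _ =>
    (tendsto_pow_apply_of_rho_lt_one hA i j).mul_const (x j)
  simpa [Matrix.mulVec, dotProduct] using this

theorem isUnit_one_sub_of_rho_lt_one {A : Matrix ι ι ℝ} (hA : rho A < 1) : IsUnit (1 - A) := by
  rw [← Matrix.mulVec_injective_iff_isUnit]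
  refine (injective_iff_map_eq_zero (Matrix.mulVecLin (1 - A))).2 fun x hx => ?_
  have hfix : A *ᵥ x = x := by
    have h : x - A *ᵥ x = 0 := by simpa [Matrix.sub_mulVec] using hx
    exact (sub_eq_zero.1 h).symm
  have hpow : ∀ n, A ^ n *ᵥ x = x := by
    intro n
    induction n with
    | zero => simp
    | succ n ih => rw [pow_succ, ← Matrix.mulVec_mulVec, hfix, ih]
  have := tendsto_pow_mulVec_of_rho_lt_one hA x
  simp only [hpow] at this
  exact tendsto_nhds_unique tendsto_const_nhds this

/-- Dominated convergence for convolution sums against the powers of `A`. -/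
theorem tendsto_sum_pow_mulVec {A : Matrix ι ι ℝ} (hA : rho A < 1) {V : ℕ → ℕ → ι → ℝ}
    {V' : ℕ → ι → ℝ} {K : ℝ} (hK : ∀ n m i, |V n m i| ≤ K)
    (hV : ∀ m, Tendsto (fun n => V n m) atTop (𝓝 (V' m))) :
    Tendsto (fun n => ∑ m ∈ Finset.range n, A ^ m *ᵥ V n m) atTop
      (𝓝 fun i => ∑' m, (A ^ m *ᵥ V' m) i) := by
  obtain ⟨C, r, hC, hr0, hr1, h⟩ := exists_abs_pow_apply_le_of_rho_lt_one hA
  refine tendsto_pi_nhds.2 fun i => ?_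
  have hentry : ∀ n m, |(A ^ m *ᵥ V n m) i| ≤ (Fintype.card ι * C * K) * r ^ m := by
    intro n m
    calc |(A ^ m *ᵥ V n m) i| ≤ ∑ j, |(A ^ m) i j * V n m j| := Finset.abs_sum_le_sum_abs _ _
      _ ≤ ∑ _j : ι, (C * r ^ m) * K := by
          refine Finset.sum_le_sum fun j _ => ?_
          rw [abs_mul]
          exact mul_le_mul (h m i j) (hK n m j) (abs_nonneg _) (by positivity)
      _ = _ := by simp; ring
  have key : Tendsto (fun n => ∑' m, if m < n then (A ^ m *ᵥ V n m) i else 0) atTop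
      (𝓝 (∑' m, (A ^ m *ᵥ V' m) i)) := by
    refine tendsto_tsum_of_dominated_convergence
      (bound := fun m => |(Fintype.card ι * C * K : ℝ)| * r ^ m)
      ((summable_geometric_of_lt_one hr0 hr1).mul_left _) (fun m => ?_) (.of_forall fun n m => ?_)
    · have : Tendsto (fun n => (A ^ m *ᵥ V n m) i) atTop (𝓝 ((A ^ m *ᵥ V' m) i)) :=
        tendsto_finsetSum _ fun j _ => ((tendsto_pi_nhds.1 (hV m) j).const_mul _)
      refine this.congr' ?_
      filter_upwards [eventually_gt_atTop m] with n hn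
      simp [hn]
    · have hb : (Fintype.card ι * C * K) * r ^ m ≤ |(Fintype.card ι * C * K : ℝ)| * r ^ m := by
        gcongr
        exact le_abs_self _
      split_ifs
      · exact (hentry n m).trans hb
      · rw [norm_zero]
        positivity
  refine key.congr fun n => ?_
  rw [tsum_eq_sum (s := Finset.range n) (fun m hm => by simp at hm; simp [hm]), Finset.sum_apply]
  exact Finset.sum_congr rfl fun m hm => by simp [Finset.mem_range.1 hm]

theorem eq_pow_mulVec_add_sum {A : Matrix ι ι ℝ} {x u : ℕ → ι → ℝ}
    (hx : ∀ n, x (n + 1) = A *ᵥ x n + u n) (n : ℕ) :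
    x n = A ^ n *ᵥ x 0 + ∑ m ∈ Finset.range n, A ^ m *ᵥ u (n - 1 - m) := by
  induction n with
  | zero => simp
  | succ n ih =>
    rw [hx, ih, Finset.sum_range_succ', Matrix.mulVec_add, Matrix.mulVec_mulVec, ← pow_succ',
      Matrix.mulVec_sum, add_assoc]
    congr 1
    simp only [Matrix.mulVec_mulVec, ← pow_succ', pow_zero, Matrix.one_mulVec]
    congr 1
    refine Finset.sum_congr rfl fun m _ => ?_
    rw [show n + 1 - 1 - (m + 1) = n - 1 - m by omega]

theorem tendsto_of_affine_recursion {A : Matrix ι ι ℝ} (hA : rho A < 1) {x u : ℕ → ι → ℝ}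
    {u' : ι → ℝ} (hx : ∀ n, x (n + 1) = A *ᵥ x n + u n) (hu : Tendsto u atTop (𝓝 u')) :
    Tendsto x atTop (𝓝 ((1 - A)⁻¹ *ᵥ u')) := by
  set y := (1 - A)⁻¹ *ᵥ u' with hy
  have hfix : A *ᵥ y + u' = y := by
    have h : (1 - A) *ᵥ y = u' := by
      rw [hy, Matrix.mulVec_mulVec, Matrix.mul_nonsing_inv _
        ((Matrix.isUnit_iff_isUnit_det _).1 (isUnit_one_sub_of_rho_lt_one hA)), Matrix.one_mulVec]
    rw [← h, Matrix.sub_mulVec, Matrix.one_mulVec]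
    abel
  have hd : ∀ n, x (n + 1) - y = A *ᵥ (x n - y) + (u n - u') := by
    intro n
    rw [hx, Matrix.mulVec_sub]
    nth_rewrite 1 [← hfix]
    abel
  have hv : Tendsto (fun n => u n - u') atTop (𝓝 0) := by
    simpa using hu.sub_const u'
  obtain ⟨K, hK⟩ : ∃ K, ∀ n, ‖u n - u'‖ ≤ K := by
    obtain ⟨K, hK⟩ := (Metric.isBounded_range_of_tendsto _ hv).exists_norm_le
    exact ⟨K, fun n => hK _ ⟨n, rfl⟩⟩
  have h2 := tendsto_sum_pow_mulVec hA (V := fun n m => u (n - 1 - m) - u') (V' := fun _ => 0)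
    (K := K) (fun n m i => (norm_le_pi_norm (u (n - 1 - m) - u') i).trans (hK _)) (fun m => by
      have : Tendsto (fun n => n - 1 - m) atTop atTop := by
        simpa [Nat.sub_sub] using tendsto_sub_atTop_nat (1 + m)
      exact hv.comp this)
  have h3 := (tendsto_pow_mulVec_of_rho_lt_one hA (x 0 - y)).add h2
  have h4 : Tendsto (fun n => x n - y) atTop (𝓝 0) := by
    have h5 := h3.congr fun n => (eq_pow_mulVec_add_sum (x := fun n => x n - y) hd n).symm
    have h0 : (fun i : ι => ∑' m, (A ^ m *ᵥ (0 : ι → ℝ)) i) = 0 := by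
      ext
      simp
    simpa only [h0, add_zero] using h5
  simpa using h4.add_const y

end MatrixPowers

/-! ### Stationary distribution of an ergodic chain -/

section StationaryDistribution

variable {N : ℕ} {P : Matrix (Fin N) (Fin N) ℝ}

theorem sum_vecMul_of_mem_rowStochastic (hP : P ∈ Matrix.rowStochastic ℝ (Fin N))
    (x : Fin N → ℝ) : ∑ j, (x ᵥ* P) j = ∑ i, x i := by
  simp only [Matrix.vecMul, dotProduct]
  rw [Finset.sum_comm]
  simp [← Finset.mul_sum, Matrix.sum_row_of_mem_rowStochastic hP]

theorem sum_abs_vecMul_le (hP : P ∈ Matrix.rowStochastic ℝ (Fin N)) (x : Fin N → ℝ) :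
    ∑ j, |(x ᵥ* P) j| ≤ ∑ i, |x i| := by
  have h : ∀ j, |(x ᵥ* P) j| ≤ ((fun i => |x i|) ᵥ* P) j := by
    intro j
    simp only [Matrix.vecMul, dotProduct]
    refine (Finset.abs_sum_le_sum_abs _ _).trans_eq ?_
    exact Finset.sum_congr rfl fun i _ => by
      rw [abs_mul, abs_of_nonneg (Matrix.nonneg_of_mem_rowStochastic hP)]
  calc ∑ j, |(x ᵥ* P) j| ≤ ∑ j, ((fun i => |x i|) ᵥ* P) j := Finset.sum_le_sum fun j _ => h j
    _ = ∑ i, |x i| := sum_vecMul_of_mem_rowStochastic hP _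

/-- Doeblin's estimate: a stochastic matrix with entries at least `δ` contracts the `ℓ¹` norm of
zero-sum row vectors. -/
theorem sum_abs_vecMul_le_of_forall_le (hP : P ∈ Matrix.rowStochastic ℝ (Fin N)) {δ : ℝ}
    (hδ : ∀ i j, δ ≤ P i j) {x : Fin N → ℝ} (hx : ∑ i, x i = 0) :
    ∑ j, |(x ᵥ* P) j| ≤ (1 - N * δ) * ∑ i, |x i| := by
  have h : ∀ j, |(x ᵥ* P) j| ≤ ∑ i, |x i| * (P i j - δ) := by
    intro j
    have h1 : (x ᵥ* P) j = ∑ i, x i * (P i j - δ) := by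
      simp [Matrix.vecMul, dotProduct, mul_sub, Finset.sum_sub_distrib, ← Finset.sum_mul, hx]
    rw [h1]
    refine (Finset.abs_sum_le_sum_abs _ _).trans_eq ?_
    exact Finset.sum_congr rfl fun i _ => by
      rw [abs_mul, abs_of_nonneg (sub_nonneg.2 (hδ i j))]
  refine (Finset.sum_le_sum fun j _ => h j).trans_eq ?_
  rw [Finset.sum_comm]
  simp only [← Finset.mul_sum, Finset.sum_sub_distrib, Matrix.sum_row_of_mem_rowStochastic hP]
  simp only [Finset.sum_const, Finset.card_univ, Fintype.card_fin, nsmul_eq_mul]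
  rw [← Finset.sum_mul, mul_comm]

/-- Some power of an ergodic transition matrix contracts zero-sum row vectors in the `ℓ¹` norm. -/
theorem exists_contraction_of_isErgodicTransition (hP : IsErgodicTransition P) :
    ∃ m r, 0 ≤ r ∧ r < 1 ∧ ∀ x : Fin N → ℝ, ∑ i, x i = 0 →
      ∑ j, |(x ᵥ* P ^ m) j| ≤ r * ∑ i, |x i| := by
  obtain ⟨hs, -, m, -, hpos⟩ := hP
  rcases Nat.eq_zero_or_pos N with rfl | hN
  · exact ⟨0, 0, le_rfl, one_pos, fun x _ => by simp⟩
  have : Nonempty (Fin N) := ⟨⟨0, hN⟩⟩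
  obtain ⟨a, ha⟩ := Finite.exists_min fun a : Fin N × Fin N => (P ^ m) a.1 a.2
  have hsm := pow_mem hs m
  have hδ0 : 0 < (P ^ m) a.1 a.2 := hpos _ _
  refine ⟨m, 1 - N * (P ^ m) a.1 a.2, ?_, ?_, fun x hx =>
    sum_abs_vecMul_le_of_forall_le hsm (fun i j => ha (i, j)) hx⟩
  · have := Matrix.sum_row_of_mem_rowStochastic hsm a.1
    have h2 : ∑ _j : Fin N, (P ^ m) a.1 a.2 ≤ ∑ j, (P ^ m) a.1 j :=
      Finset.sum_le_sum fun j _ => ha (a.1, j)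
    simp at h2
    linarith
  · have : (0 : ℝ) < N := by exact_mod_cast hN
    nlinarith

theorem tendsto_vecMul_pow_of_sum_eq_zero (hP : IsErgodicTransition P) {x : Fin N → ℝ}
    (hx : ∑ i, x i = 0) : Tendsto (fun n => x ᵥ* P ^ n) atTop (𝓝 0) := by
  obtain ⟨m, r, hr0, hr1, h⟩ := exists_contraction_of_isErgodicTransition hP
  set a : ℕ → ℝ := fun n => ∑ j, |(x ᵥ* P ^ n) j| with ha
  have hsum : ∀ n, ∑ j, (x ᵥ* P ^ n) j = 0 := fun n =>
    (sum_vecMul_of_mem_rowStochastic (pow_mem hP.1 n) x).trans hx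
  have hanti : Antitone a := antitone_nat_of_succ_le fun n => by
    simpa [ha, pow_succ, ← Matrix.vecMul_vecMul] using sum_abs_vecMul_le hP.1 (x ᵥ* P ^ n)
  have hstep : ∀ n, a (n + m) ≤ r * a n := fun n => by
    simpa [ha, pow_add, ← Matrix.vecMul_vecMul] using h _ (hsum n)
  have ha0 : ∀ n, 0 ≤ a n := fun n => Finset.sum_nonneg fun _ _ => abs_nonneg _
  have hlim := tendsto_atTop_ciInf hanti ⟨0, by rintro _ ⟨n, rfl⟩; exact ha0 n⟩
  set L := ⨅ n, a n
  have hL0 : 0 ≤ L := ge_of_tendsto' hlim ha0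
  have hL : L ≤ r * L :=
    le_of_tendsto_of_tendsto' ((tendsto_add_atTop_iff_nat m).2 hlim) (hlim.const_mul r) hstep
  have hLz : L = 0 := by nlinarith
  rw [hLz] at hlim
  refine tendsto_pi_nhds.2 fun j => squeeze_zero_norm (fun n => ?_) hlim
  exact Finset.single_le_sum (f := fun j => |(x ᵥ* P ^ n) j|) (fun _ _ => abs_nonneg _)
    (Finset.mem_univ j)

theorem IsStationaryDistribution.vecMul_pow {π : Fin N → ℝ} (hπ : IsStationaryDistribution P π)
    (n : ℕ) : π ᵥ* P ^ n = π := by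
  induction n with
  | zero => simp
  | succ n ih => rw [pow_succ, ← Matrix.vecMul_vecMul, ih, hπ.2.2]

theorem IsStationaryDistribution.tendsto_vecMul_pow (hP : IsErgodicTransition P) {π : Fin N → ℝ}
    (hπ : IsStationaryDistribution P π) {x : Fin N → ℝ} (hx : ∑ i, x i = 1) :
    Tendsto (fun n => x ᵥ* P ^ n) atTop (𝓝 π) := by
  have h := (tendsto_vecMul_pow_of_sum_eq_zero hP (x := x - π)
    (by simp [Finset.sum_sub_distrib, hx, hπ.2.1])).add_const π
  simpa [Matrix.sub_vecMul, hπ.vecMul_pow] using h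

theorem existsUnique_isStationaryDistribution (hP : IsErgodicTransition P) (hN : 0 < N) :
    ∃! π : Fin N → ℝ, IsStationaryDistribution P π := by
  obtain ⟨m, r, hr0, hr1, h⟩ := exists_contraction_of_isErgodicTransition hP
  -- a fixed point of `P` in the affine hyperplane of sum `1`; its sign is settled afterwards
  set x₀ : Fin N → ℝ := Pi.single ⟨0, hN⟩ 1 with hx₀
  have hx1 : ∑ i, x₀ i = 1 := by simp [hx₀]
  have hx0 : ∀ i, 0 ≤ x₀ i := fun i => by
    by_cases hi : i = ⟨0, hN⟩ <;> simp [hx₀, hi]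
  let Z : Submodule ℝ (Fin N → ℝ) := LinearMap.ker (∑ i, LinearMap.proj i : (Fin N → ℝ) →ₗ[ℝ] ℝ)
  have hZ : ∀ x, x ∈ Z ↔ ∑ i, x i = 0 := fun x => by simp [Z]
  let T : (Fin N → ℝ) →ₗ[ℝ] (Fin N → ℝ) := LinearMap.id - Matrix.vecMulLinear P
  have hT : ∀ x, T x = x - x ᵥ* P := fun x => by simp [T]
  have hTZ : ∀ x ∈ Z, T x ∈ Z := fun x hx => by
    rw [hZ] at hx ⊢
    simp [hT, Finset.sum_sub_distrib, sum_vecMul_of_mem_rowStochastic hP.1]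
  have hinj : Function.Injective (T.restrict hTZ) := by
    refine (injective_iff_map_eq_zero _).2 fun x hx => ?_
    have hfix : (x : Fin N → ℝ) ᵥ* P = x := by
      have h : T x = 0 := by simpa using congrArg Subtype.val hx
      rw [hT] at h
      exact (sub_eq_zero.1 h).symm
    have hpow : ∀ n, (x : Fin N → ℝ) ᵥ* P ^ n = x := fun n => by
      induction n with
      | zero => simp
      | succ n ih => rw [pow_succ, ← Matrix.vecMul_vecMul, ih, hfix]
    have := tendsto_vecMul_pow_of_sum_eq_zero hP ((hZ _).1 x.2)
    simp only [hpow] at this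
    exact Subtype.ext (tendsto_nhds_unique tendsto_const_nhds this)
  obtain ⟨⟨d, hdZ⟩, hd⟩ := (LinearMap.injective_iff_surjective.1 hinj)
    ⟨x₀ ᵥ* P - x₀, by
      rw [hZ]; simp [Finset.sum_sub_distrib, sum_vecMul_of_mem_rowStochastic hP.1]⟩
  have hd' : d - d ᵥ* P = x₀ ᵥ* P - x₀ := by
    rw [← hT]; exact congrArg Subtype.val hd
  have hπfix : (x₀ + d) ᵥ* P = x₀ + d := by
    rw [Matrix.add_vecMul]
    have := sub_eq_sub_iff_add_eq_add.1 hd'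
    rw [add_comm x₀, this]
  have hπsum : ∑ i, (x₀ + d : Fin N → ℝ) i = 1 := by
    simp [Finset.sum_add_distrib, hx1, (hZ _).1 hdZ]
  have hpow : ∀ n, (x₀ + d : Fin N → ℝ) ᵥ* P ^ n = x₀ + d := fun n => by
    induction n with
    | zero => simp
    | succ n ih => rw [pow_succ, ← Matrix.vecMul_vecMul, ih, hπfix]
  have hlim : Tendsto (fun n => x₀ ᵥ* P ^ n) atTop (𝓝 (x₀ + d)) := by
    have h := (tendsto_vecMul_pow_of_sum_eq_zero hP (x := x₀ - (x₀ + d))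
      (by rw [Finset.sum_congr rfl fun i _ => Pi.sub_apply x₀ (x₀ + d) i,
        Finset.sum_sub_distrib, hπsum, hx1, sub_self])).add_const (x₀ + d : Fin N → ℝ)
    simp only [Matrix.sub_vecMul, hpow, sub_add_cancel, zero_add] at h
    exact h
  have hπ : IsStationaryDistribution P (x₀ + d) :=
    ⟨fun i => ge_of_tendsto' (tendsto_pi_nhds.1 hlim i) fun n =>
      Matrix.nonneg_vecMul_of_mem_rowStochastic (pow_mem hP.1 n) hx0 i, hπsum, hπfix⟩
  exact ⟨_, hπ, fun π' hπ' =>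
    tendsto_nhds_unique (hπ'.tendsto_vecMul_pow hP hx1) (hπ.tendsto_vecMul_pow hP hx1)⟩

end StationaryDistribution

/-! ### The matrices of the error system -/

section SystemMatrices

variable {nb nr N : ℕ}

namespace WeightedGraph

variable (G : WeightedGraph nb nr)

theorem W_nonneg (u v : Node nb nr) : 0 ≤ G.W u v := by
  by_cases huv : u = v
  · exact huv ▸ (G.pos_self u).le
  · by_cases h : G.graph.Adj u v
    · exact (G.pos_of_adj u v h).le
    · exact (G.eq_zero u v huv h).ge

theorem Jb_apply (u v : Fin nb) : G.Jb u v = G.W (.inl u) (.inl v) / ∑ w, G.W (.inl u) w := by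
  have hinv : basis G.rowPart + basis G.diagPart =
      Matrix.diagonal fun u : Fin nb => ∑ w, G.W (.inl u) w := by
    rw [basis, basis, rowPart, diagPart, Matrix.submatrix_diagonal _ _ Sum.inl_injective,
      Matrix.submatrix_diagonal _ _ Sum.inl_injective, Matrix.diagonal_add]
    congr 1
    ext u
    simp
  have hW : basis G.offPart + basis G.diagPart = basis G.W := by
    ext u v
    simp [basis, offPart]
  have hpos : ∀ u : Fin nb, ∑ w, G.W (.inl u) w ≠ 0 := fun u =>
    (Finset.sum_pos' (fun w _ => G.W_nonneg _ w) ⟨.inl u, Finset.mem_univ _, G.pos_self _⟩).ne'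
  have hr : (Matrix.diagonal fun u : Fin nb => ∑ w, G.W (.inl u) w)⁻¹ =
      Matrix.diagonal fun u => (∑ w, G.W (.inl u) w)⁻¹ := by
    refine Matrix.inv_eq_left_inv ?_
    rw [Matrix.diagonal_mul_diagonal, ← Matrix.diagonal_one]
    congr 1
    ext u
    exact inv_mul_cancel₀ (hpos u)
  rw [Jb, hinv, hW, hr, Matrix.diagonal_mul, basis, Matrix.submatrix_apply,
    div_eq_inv_mul]

theorem Jb_nonneg (u v : Fin nb) : 0 ≤ G.Jb u v := by
  rw [Jb_apply]
  exact div_nonneg (G.W_nonneg _ _) (Finset.sum_nonneg fun w _ => G.W_nonneg _ w)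

theorem Jb_diag_pos (u : Fin nb) : 0 < G.Jb u u := by
  rw [Jb_apply]
  exact div_pos (G.pos_self _)
    (Finset.sum_pos' (fun w _ => G.W_nonneg _ w) ⟨.inl u, Finset.mem_univ _, G.pos_self _⟩)

theorem Jb_mulVec_pos {x : Fin nb → ℝ} (hx : ∀ u, 0 < x u) (u : Fin nb) : 0 < (G.Jb *ᵥ x) u :=
  Finset.sum_pos' (fun v _ => mul_nonneg (G.Jb_nonneg u v) (hx v).le)
    ⟨u, Finset.mem_univ _, mul_pos (G.Jb_diag_pos u) (hx u)⟩

end WeightedGraph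

variable (G : Fin N → WeightedGraph nb nr) {P : Matrix (Fin N) (Fin N) ℝ}

theorem calD_nonneg (hP : ∀ i j, 0 ≤ P i j) (a b : Fin N × (Fin nb × Fin nb)) :
    0 ≤ calD G P a b :=
  mul_nonneg (hP _ _) (mul_nonneg ((G b.1).Jb_nonneg _ _) ((G b.1).Jb_nonneg _ _))

variable (P) in
theorem calD_mulVec_hatPhi (V : Fin N → Matrix (Fin nb) (Fin nb) ℝ) :
    calD G P *ᵥ hatPhi N nb V =
      hatPhi N nb fun i => ∑ j, P j i • ((G j).Jb * V j * (G j).Jbᵀ) := by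
  ext ⟨i, a⟩
  have h : ∀ j, ∑ b, calD G P (i, a) (j, b) * hatPhi N nb V (j, b) =
      P j i * ((G j).Jb * V j * (G j).Jbᵀ) a.2 a.1 := by
    intro j
    have := congrFun (Matrix.kronecker_mulVec_vec (G j).Jb (V j) (G j).Jb) a
    rw [Matrix.vec] at this
    rw [← this, Matrix.mulVec, dotProduct, Finset.mul_sum]
    exact Finset.sum_congr rfl fun b _ => by simp [calD, hatPhi, mul_assoc]
  rw [Matrix.mulVec, dotProduct, Fintype.sum_prod_type]
  simp only [h]
  simp [hatPhi, Matrix.vec, Matrix.sum_apply]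

variable (P) in
theorem calC_mulVec_apply (x : Fin N × Fin nb → ℝ) (i : Fin N) (u : Fin nb) :
    (calC G P *ᵥ x) (i, u) = ∑ j, P j i * ((G j).Jb *ᵥ fun v => x (j, v)) u := by
  rw [Matrix.mulVec, dotProduct, Fintype.sum_prod_type]
  refine Finset.sum_congr rfl fun j _ => ?_
  rw [Matrix.mulVec, dotProduct, Finset.mul_sum]
  exact Finset.sum_congr rfl fun v _ => by simp [calC, mul_assoc]

/-- The pair `(q, V)` with weights `p` behaves like the moments of a random vector on the events of
probability `p i`: the block matrices `[[V i, q i], [(q i)ᵀ, p i]]` are positive semidefinite, stated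
through the Cauchy-Schwarz inequality. -/
structure IsMomentTuple (q : Fin N → Fin nb → ℝ) (V : Fin N → Matrix (Fin nb) (Fin nb) ℝ)
    (p : Fin N → ℝ) : Prop where
  nonneg : ∀ i, 0 ≤ p i
  quad_nonneg : ∀ i w, 0 ≤ w ⬝ᵥ V i *ᵥ w
  sq_le : ∀ i w, (w ⬝ᵥ q i) ^ 2 ≤ (w ⬝ᵥ V i *ᵥ w) * p i

theorem IsMomentTuple.step (hP : ∀ i j, 0 ≤ P i j) {q : Fin N → Fin nb → ℝ}
    {V : Fin N → Matrix (Fin nb) (Fin nb) ℝ} {p : Fin N → ℝ} (h : IsMomentTuple q V p) :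
    IsMomentTuple (fun i => ∑ j, P j i • ((G j).Jb *ᵥ q j))
      (fun i => ∑ j, P j i • ((G j).Jb * V j * (G j).Jbᵀ)) (p ᵥ* P) := by
  have hq : ∀ i w, w ⬝ᵥ (∑ j, P j i • ((G j).Jb *ᵥ q j)) =
      ∑ j, P j i * (((G j).Jbᵀ *ᵥ w) ⬝ᵥ q j) := fun i w => by
    rw [dotProduct_sum]
    exact Finset.sum_congr rfl fun j _ => by
      rw [dotProduct_smul, Matrix.dotProduct_mulVec, Matrix.mulVec_transpose, smul_eq_mul]
  have hV : ∀ i w, w ⬝ᵥ (∑ j, P j i • ((G j).Jb * V j * (G j).Jbᵀ)) *ᵥ w =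
      ∑ j, P j i * (((G j).Jbᵀ *ᵥ w) ⬝ᵥ V j *ᵥ ((G j).Jbᵀ *ᵥ w)) := fun i w => by
    rw [Matrix.sum_mulVec, dotProduct_sum]
    refine Finset.sum_congr rfl fun j _ => ?_
    rw [Matrix.smul_mulVec, dotProduct_smul, smul_eq_mul, ← Matrix.mulVec_mulVec,
      ← Matrix.mulVec_mulVec, Matrix.dotProduct_mulVec w, ← Matrix.mulVec_transpose (G j).Jb w]
  refine ⟨fun i => show 0 ≤ ∑ j, p j * P j i from
    Finset.sum_nonneg fun j _ => mul_nonneg (h.nonneg j) (hP j i), fun i w => ?_, fun i w => ?_⟩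
  · rw [hV]
    exact Finset.sum_nonneg fun j _ => mul_nonneg (hP j i) (h.quad_nonneg _ _)
  · rw [hq, hV]
    refine Finset.sum_sq_le_sum_mul_sum_of_sq_le_mul _
      (fun j _ => mul_nonneg (hP j i) (h.quad_nonneg _ _))
      (fun j _ => mul_nonneg (h.nonneg j) (hP j i)) fun j _ => ?_
    nlinarith [mul_le_mul_of_nonneg_left (h.sq_le j ((G j).Jbᵀ *ᵥ w)) (mul_nonneg (hP j i) (hP j i))]

/-- Second moments dominate first moments, so decay of the powers of `calD` forces decay of the
powers of `calC`. -/
theorem rho_calC_lt_one (hP : P ∈ Matrix.rowStochastic ℝ (Fin N)) (hD : rho (calD G P) < 1) :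
    rho (calC G P) < 1 := by
  refine rho_lt_one_of_tendsto_pow fun a b => ?_
  have hP0 : ∀ i j, 0 ≤ P i j := fun i j => hP.1 i j
  set x : Fin N × Fin nb → ℝ := Pi.single b 1
  set V : Fin N → Matrix (Fin nb) (Fin nb) ℝ := fun i =>
    Matrix.vecMulVec (fun u => x (i, u)) fun u => x (i, u)
  have hmom : ∀ n, IsMomentTuple (fun i u => (calC G P ^ n *ᵥ x) (i, u))
      ((hatPhi N nb).symm (calD G P ^ n *ᵥ hatPhi N nb V)) (1 ᵥ* P ^ n) := by
    intro n
    induction n with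
    | zero =>
      have hw : ∀ i w, w ⬝ᵥ V i *ᵥ w = (w ⬝ᵥ fun u => x (i, u)) ^ 2 := fun i w => by
        simp [V, Matrix.vecMulVec_mulVec, sq, dotProduct_comm]
      simp only [pow_zero, Matrix.one_mulVec, Matrix.vecMul_one, Equiv.symm_apply_apply]
      exact ⟨fun _ => zero_le_one, fun i w => by rw [hw]; positivity,
        fun i w => by rw [hw]; simp⟩
    | succ n ih =>
      have h := ih.step G hP0
      rw [Matrix.vecMul_vecMul, ← pow_succ] at h
      convert h using 1
      · ext i u
        rw [pow_succ', ← Matrix.mulVec_mulVec, calC_mulVec_apply]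
        simp [Finset.sum_apply]
      · rw [pow_succ', ← Matrix.mulVec_mulVec, Equiv.symm_apply_eq, ← calD_mulVec_hatPhi,
          Equiv.apply_symm_apply]
  obtain ⟨i, u⟩ := a
  have hp : ∀ n, ((1 : Fin N → ℝ) ᵥ* P ^ n) i ≤ N := fun n => by
    have h := Finset.single_le_sum (fun j _ => (hmom n).nonneg j) (Finset.mem_univ i)
    rw [sum_vecMul_of_mem_rowStochastic (pow_mem hP n)] at h
    simpa using h
  have hsq : ∀ n, ((calC G P ^ n) (i, u) b) ^ 2 ≤
      (calD G P ^ n *ᵥ hatPhi N nb V) (i, (u, u)) * N := fun n => by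
    have h := (hmom n).sq_le i (Pi.single u 1)
    have h0 := (hmom n).quad_nonneg i (Pi.single u 1)
    simp only [x, single_dotProduct, one_mul, Matrix.mulVec_single_one, Matrix.col_apply] at h h0
    exact h.trans (mul_le_mul_of_nonneg_left (hp n) h0)
  have hlim := ((tendsto_pi_nhds.1 (tendsto_pow_mulVec_of_rho_lt_one hD (hatPhi N nb V)))
    (i, (u, u))).mul_const (N : ℝ)
  rw [Pi.zero_apply, zero_mul] at hlim
  have hsq0 := squeeze_zero (fun n => sq_nonneg _) hsq hlim
  have := hsq0.sqrt
  simp only [Real.sqrt_sq_eq_abs, Real.sqrt_zero] at this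
  exact (tendsto_zero_iff_abs_tendsto_zero _).2 this

/-- If the powers of a nonnegative matrix drive one positive vector to zero, its spectral radius is
less than one. -/
theorem rho_lt_one_of_tendsto_pow_mulVec {ι : Type*} [Fintype ι] [DecidableEq ι]
    {A : Matrix ι ι ℝ} (hA : ∀ a b, 0 ≤ A a b) {v : ι → ℝ} (hv : ∀ a, 0 < v a)
    (h : Tendsto (fun n => A ^ n *ᵥ v) atTop (𝓝 0)) : rho A < 1 := by
  have hpow : ∀ n a b, 0 ≤ (A ^ n) a b := by
    intro n
    induction n with
    | zero => intro a b; rw [pow_zero, Matrix.one_apply]; split_ifs <;> simp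
    | succ n ih =>
      intro a b
      rw [pow_succ]
      exact Finset.sum_nonneg fun c _ => mul_nonneg (ih a c) (hA c b)
  refine rho_lt_one_of_tendsto_pow fun a b => ?_
  have hlim := (tendsto_pi_nhds.1 h a).div_const (v b)
  rw [Pi.zero_apply, zero_div] at hlim
  refine squeeze_zero (fun n => hpow n a b) (fun n => ?_) hlim
  rw [le_div_iff₀ (hv b)]
  exact Finset.single_le_sum (f := fun b => (A ^ n) a b * v b)
    (fun c _ => mul_nonneg (hpow n a c) (hv c).le) (Finset.mem_univ b)

end SystemMatrices

/-! ### The Markov property with respect to a filtration -/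

section MarkovFiltration

variable {N : ℕ} {Ω : Type*} [mΩ : MeasurableSpace Ω] {Pr : Measure Ω} {P : Matrix (Fin N) (Fin N) ℝ}
  {θ : ℕ → Ω → Fin N} {𝓖 : Filtration ℕ mΩ}

/-- `θ` is adapted to `𝓖` and moves with the transition probabilities `P` when the past `𝓖 n` is
known. -/
structure IsMarkovFor (Pr : Measure Ω) (P : Matrix (Fin N) (Fin N) ℝ) (θ : ℕ → Ω → Fin N)
    (𝓖 : Filtration ℕ mΩ) : Prop where
  nonneg : ∀ i j, 0 ≤ P i j
  adapted : ∀ n, Measurable[𝓖 n] (θ n)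
  markov : ∀ n j i A, MeasurableSet[𝓖 n] A →
    Pr (A ∩ (θ n ⁻¹' {j} ∩ θ (n + 1) ⁻¹' {i})) = ENNReal.ofReal (P j i) * Pr (A ∩ θ n ⁻¹' {j})

namespace IsMarkovFor

theorem measurableSet_preimage (h : IsMarkovFor Pr P θ 𝓖) (n : ℕ) (j : Fin N) :
    MeasurableSet (θ n ⁻¹' {j}) :=
  (h.adapted n).mono (𝓖.le n) le_rfl (MeasurableSet.singleton j)

theorem setIntegral_inter (h : IsMarkovFor Pr P θ 𝓖) {n : ℕ} {F : Ω → ℝ}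
    (hF : Measurable[𝓖 n] F) (j i : Fin N) :
    ∫ ω in θ n ⁻¹' {j} ∩ θ (n + 1) ⁻¹' {i}, F ω ∂Pr = P j i * ∫ ω in θ n ⁻¹' {j}, F ω ∂Pr := by
  have hm := 𝓖.le n
  have htrim : (Pr.restrict (θ n ⁻¹' {j} ∩ θ (n + 1) ⁻¹' {i})).trim hm =
      ENNReal.ofReal (P j i) • (Pr.restrict (θ n ⁻¹' {j})).trim hm := by
    refine @Measure.ext _ (𝓖 n) _ _ fun A hA => ?_
    rw [Measure.smul_apply, trim_measurableSet_eq hm hA, trim_measurableSet_eq hm hA,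
      Measure.restrict_apply (hm A hA), Measure.restrict_apply (hm A hA), h.markov n j i A hA,
      smul_eq_mul]
  have hs : StronglyMeasurable[𝓖 n] F := hF.stronglyMeasurable
  rw [integral_trim hm hs, htrim, integral_smul_measure, ← integral_trim hm hs,
    ENNReal.toReal_ofReal (h.nonneg j i), smul_eq_mul]

/-- One step of the chain: an integral over the states at time `n + 1` of a quantity known at time
`n` and depending on the mode at time `n`. -/
theorem setIntegral_succ (h : IsMarkovFor Pr P θ 𝓖) {n : ℕ} {F : Fin N → Ω → ℝ}
    (hF : ∀ j, Measurable[𝓖 n] (F j)) (hint : ∀ j, Integrable (F j) Pr) (i : Fin N) :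
    ∫ ω in θ (n + 1) ⁻¹' {i}, F (θ n ω) ω ∂Pr = ∑ j, P j i * ∫ ω in θ n ⁻¹' {j}, F j ω ∂Pr := by
  have hcongr : ∀ j, Set.EqOn (F j) (fun ω => F (θ n ω) ω)
      (θ n ⁻¹' {j} ∩ θ (n + 1) ⁻¹' {i}) := by
    rintro j ω ⟨hω, -⟩
    have hω' : θ n ω = j := hω
    simp only [hω']
  have hmeas : ∀ j, MeasurableSet (θ n ⁻¹' {j} ∩ θ (n + 1) ⁻¹' {i}) := fun j =>
    (h.measurableSet_preimage n j).inter (h.measurableSet_preimage (n + 1) i)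
  have hU : θ (n + 1) ⁻¹' {i} = ⋃ j, θ n ⁻¹' {j} ∩ θ (n + 1) ⁻¹' {i} := by
    ext ω
    simp
  rw [hU, integral_iUnion_fintype hmeas]
  · refine Finset.sum_congr rfl fun j _ => ?_
    rw [← h.setIntegral_inter (hF j)]
    exact (setIntegral_congr_fun (hmeas j) (hcongr j)).symm
  · intro j k hjk
    refine Set.disjoint_left.2 ?_
    rintro ω ⟨hj, -⟩ ⟨hk, -⟩
    exact hjk ((show θ n ω = j from hj).symm.trans hk)
  · exact fun j => ((hint j).integrableOn).congr_fun (hcongr j) (hmeas j)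

theorem sum_setIntegral (h : IsMarkovFor Pr P θ 𝓖) (n : ℕ) {F : Ω → ℝ} (hF : Integrable F Pr) :
    ∑ j, ∫ ω in θ n ⁻¹' {j}, F ω ∂Pr = ∫ ω, F ω ∂Pr := by
  have hU : ⋃ j, θ n ⁻¹' {j} = Set.univ := by
    ext ω
    simp
  rw [← setIntegral_univ, ← hU, integral_iUnion_fintype (h.measurableSet_preimage n)]
  · intro j k hjk
    refine Set.disjoint_left.2 fun ω hj hk => ?_
    exact hjk ((show θ n ω = j from hj).symm.trans hk)
  · exact fun j => hF.integrableOn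

theorem real_preimage_succ [IsFiniteMeasure Pr] (h : IsMarkovFor Pr P θ 𝓖) (n : ℕ) :
    (fun i => Pr.real (θ (n + 1) ⁻¹' {i})) = (fun i => Pr.real (θ n ⁻¹' {i})) ᵥ* P := by
  ext i
  have := h.setIntegral_succ (n := n) (F := fun _ _ => 1) (fun _ => measurable_const)
    (fun _ => integrable_const 1) i
  simpa [Matrix.vecMul, dotProduct, mul_comm] using this

theorem real_preimage_eq [IsFiniteMeasure Pr] (h : IsMarkovFor Pr P θ 𝓖) (n : ℕ) :
    (fun i => Pr.real (θ n ⁻¹' {i})) = (fun i => Pr.real (θ 0 ⁻¹' {i})) ᵥ* P ^ n := by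
  induction n with
  | zero => simp
  | succ n ih => rw [h.real_preimage_succ, ih, Matrix.vecMul_vecMul, pow_succ]

theorem sum_real_preimage [IsProbabilityMeasure Pr] (h : IsMarkovFor Pr P θ 𝓖) (n : ℕ) :
    ∑ i, Pr.real (θ n ⁻¹' {i}) = 1 := by
  simpa using h.sum_setIntegral n (integrable_const (μ := Pr) (1 : ℝ))

theorem tendsto_real_preimage [IsProbabilityMeasure Pr] (h : IsMarkovFor Pr P θ 𝓖)
    (hP : IsErgodicTransition P) {π : Fin N → ℝ} (hπ : IsStationaryDistribution P π) (i : Fin N) :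
    Tendsto (fun n => Pr.real (θ n ⁻¹' {i})) atTop (𝓝 (π i)) := by
  have := tendsto_pi_nhds.1 (hπ.tendsto_vecMul_pow hP (h.sum_real_preimage 0)) i
  exact this.congr fun n => (congrFun (h.real_preimage_eq n) i).symm

theorem exists_forall_real_preimage_pos [IsProbabilityMeasure Pr] (h : IsMarkovFor Pr P θ 𝓖)
    (hP : IsErgodicTransition P) : ∃ n, ∀ i, 0 < Pr.real (θ n ⁻¹' {i}) := by
  obtain ⟨m, -, hm⟩ := hP.2.exists_pos_pow
  have hex : ∃ j, 0 < Pr.real (θ 0 ⁻¹' {j}) := by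
    by_contra! hle
    have := h.sum_real_preimage 0
    have h0 : ∑ i, Pr.real (θ 0 ⁻¹' {i}) ≤ 0 := Finset.sum_nonpos fun i _ => hle i
    linarith
  obtain ⟨j, hj⟩ := hex
  refine ⟨m, fun i => ?_⟩
  rw [congrFun (h.real_preimage_eq m) i]
  refine Finset.sum_pos' (f := fun k => Pr.real (θ 0 ⁻¹' {k}) * (P ^ m) k i)
    (fun k _ => mul_nonneg measureReal_nonneg (hm k i).le) ⟨j, Finset.mem_univ j, mul_pos hj (hm j i)⟩

end IsMarkovFor

/-- The information given by `x` and by the path of `θ` up to time `k₀ + n`. -/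
def pathFiltration {E : Type*} [MeasurableSpace E] (k₀ : ℕ) {x : Ω → E} (hx : Measurable x)
    (hθ : ∀ k, Measurable (θ k)) : Filtration ℕ mΩ where
  seq n := MeasurableSpace.comap (fun ω => (x ω, fun l : Fin (k₀ + n + 1) => θ l ω)) inferInstance
  mono' m n hmn := by
    refine Measurable.comap_le ?_
    have hcomp : (fun ω => (x ω, fun l : Fin (k₀ + m + 1) => θ l ω)) =
        (fun p : E × (Fin (k₀ + n + 1) → Fin N) =>
          (p.1, fun l : Fin (k₀ + m + 1) => p.2 (Fin.castLE (by omega) l))) ∘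
        fun ω => (x ω, fun l : Fin (k₀ + n + 1) => θ l ω) := rfl
    rw [hcomp]
    refine Measurable.comp ?_ (comap_measurable _)
    fun_prop
  le' n := (hx.prodMk (measurable_pi_lambda (fun ω (l : Fin (k₀ + n + 1)) => θ l ω)
    fun l => hθ l)).comap_le

variable {E : Type*} [MeasurableSpace E] {k₀ : ℕ} {x : Ω → E}

theorem measurable_pathFiltration (hx : Measurable x) (hθ : ∀ k, Measurable (θ k)) (n : ℕ) :
    Measurable[pathFiltration k₀ hx hθ n] x :=
  measurable_fst.comp (comap_measurable fun ω => (x ω, fun l : Fin (k₀ + n + 1) => θ l ω))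

/-- A Markov property tested on cylinders extends to all events known at time `k₀ + n`. -/
theorem isMarkovFor_pathFiltration (hP : ∀ i j, 0 ≤ P i j) (hx : Measurable x)
    (hθ : ∀ k, Measurable (θ k))
    (hmarkov : ∀ S, MeasurableSet S → ∀ k ≥ k₀, ∀ s : ℕ → Fin N,
      Pr {ω | x ω ∈ S ∧ ∀ l ≤ k + 1, θ l ω = s l} =
        Pr {ω | x ω ∈ S ∧ ∀ l ≤ k, θ l ω = s l} * ENNReal.ofReal (P (s k) (s (k + 1)))) :
    IsMarkovFor Pr P (fun n => θ (k₀ + n)) (pathFiltration k₀ hx hθ) where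
  nonneg := hP
  adapted n := by
    have h : θ (k₀ + n) = (fun p : E × (Fin (k₀ + n + 1) → Fin N) => p.2 (Fin.last (k₀ + n))) ∘
        fun ω => (x ω, fun l : Fin (k₀ + n + 1) => θ l ω) := rfl
    rw [h]
    exact Measurable.comp (by fun_prop) (comap_measurable _)
  markov n j i A hA := by
    obtain ⟨B, hB, rfl⟩ := hA
    revert B
    change ∀ B : Set (E × (Fin (k₀ + n + 1) → Fin N)), MeasurableSet B →
      Pr ((fun ω => (x ω, fun l : Fin (k₀ + n + 1) => θ l ω)) ⁻¹' B ∩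
        (θ (k₀ + n) ⁻¹' {j} ∩ θ (k₀ + n + 1) ⁻¹' {i})) = ENNReal.ofReal (P j i) *
        Pr ((fun ω => (x ω, fun l : Fin (k₀ + n + 1) => θ l ω)) ⁻¹' B ∩ θ (k₀ + n) ⁻¹' {j})
    have hk : k₀ ≤ k₀ + n := Nat.le_add_right _ _
    generalize k₀ + n = k at hk ⊢
    intro B hB
    let s : (Fin (k + 1) → Fin N) → ℕ → Fin N := fun t l =>
      if h : l < k + 1 then t ⟨l, h⟩ else i
    have hs : ∀ t (l : Fin (k + 1)), s t l = t l := fun t l => dif_pos l.2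
    let S : (Fin (k + 1) → Fin N) → Set E := fun t => (fun y => (y, t)) ⁻¹' B
    have hS : ∀ t, MeasurableSet (S t) := fun t => measurable_prodMk_right hB
    let T : Finset (Fin (k + 1) → Fin N) := Finset.univ.filter fun t => t (Fin.last k) = j
    have hpath : ∀ t ω, (∀ l ≤ k, θ l ω = s t l) ↔ (fun l : Fin (k + 1) => θ l ω) = t := by
      intro t ω
      rw [funext_iff]
      exact ⟨fun h l => (h l (Nat.lt_succ_iff.1 l.2)).trans (hs t l),
        fun h l hl => (h ⟨l, Nat.lt_succ_of_le hl⟩).trans (hs t ⟨l, Nat.lt_succ_of_le hl⟩).symm⟩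
    have hpath' : ∀ t ω, (∀ l ≤ k + 1, θ l ω = s t l) ↔
        (fun l : Fin (k + 1) => θ l ω) = t ∧ θ (k + 1) ω = i := by
      intro t ω
      have hlast : s t (k + 1) = i := by simp [s]
      rw [← hpath]
      refine ⟨fun h => ⟨fun l hl => h l (by omega), (h (k + 1) le_rfl).trans hlast⟩, ?_⟩
      rintro ⟨h1, h2⟩ l hl
      rcases Nat.lt_or_ge l (k + 1) with hlt | hge
      · exact h1 l (by omega)
      · obtain rfl : l = k + 1 := by omega
        exact h2.trans hlast.symm
    have hevent : ∀ (t : Fin (k + 1) → Fin N) (m : ℕ),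
        MeasurableSet {ω | x ω ∈ S t ∧ ∀ l ≤ m, θ l ω = s t l} := by
      intro t m
      refine (hx (hS t)).inter ?_
      have : {ω | ∀ l ≤ m, θ l ω = s t l} = ⋂ l, ⋂ _ : l ≤ m, θ l ⁻¹' {s t l} := by
        ext ω
        simp
      change MeasurableSet {ω | ∀ l ≤ m, θ l ω = s t l}
      rw [this]
      exact .iInter fun l => .iInter fun _ => hθ l (MeasurableSet.singleton _)
    have hdisj : ∀ m, k ≤ m → Set.PairwiseDisjoint (T : Set (Fin (k + 1) → Fin N))
        fun t => {ω | x ω ∈ S t ∧ ∀ l ≤ m, θ l ω = s t l} := by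
      intro m hm t _ t' _ htt'
      refine Set.disjoint_left.2 fun ω hω hω' => htt' ?_
      rw [← (hpath t ω).1 fun l hl => hω.2 l (hl.trans hm),
        ← (hpath t' ω).1 fun l hl => hω'.2 l (hl.trans hm)]
    have hlhs : (fun ω => (x ω, fun l : Fin (k + 1) => θ l ω)) ⁻¹' B ∩
        (θ k ⁻¹' {j} ∩ θ (k + 1) ⁻¹' {i}) =
        ⋃ t ∈ T, {ω | x ω ∈ S t ∧ ∀ l ≤ k + 1, θ l ω = s t l} := by
      ext ω
      simp only [hpath', Set.mem_inter_iff, Set.mem_preimage, Set.mem_singleton_iff,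
        Set.mem_iUnion, Set.mem_ofPred_eq, T, S, Finset.mem_filter, Finset.mem_univ, true_and,
        exists_prop]
      constructor
      · rintro ⟨h1, h2, h3⟩
        exact ⟨_, h2, h1, rfl, h3⟩
      · rintro ⟨t, h2, h1, rfl, h3⟩
        exact ⟨h1, h2, h3⟩
    have hrhs : (fun ω => (x ω, fun l : Fin (k + 1) => θ l ω)) ⁻¹' B ∩ θ k ⁻¹' {j} =
        ⋃ t ∈ T, {ω | x ω ∈ S t ∧ ∀ l ≤ k, θ l ω = s t l} := by
      ext ω
      simp only [hpath, Set.mem_inter_iff, Set.mem_preimage, Set.mem_singleton_iff,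
        Set.mem_iUnion, Set.mem_ofPred_eq, T, S, Finset.mem_filter, Finset.mem_univ, true_and,
        exists_prop]
      constructor
      · rintro ⟨h1, h2⟩
        exact ⟨_, h2, h1, rfl⟩
      · rintro ⟨t, h2, h1, rfl⟩
        exact ⟨h1, h2⟩
    rw [hlhs, hrhs, measure_biUnion_finset (hdisj _ (Nat.le_succ k)) fun t _ => hevent t _,
      measure_biUnion_finset (hdisj _ le_rfl) fun t _ => hevent t _, Finset.mul_sum]
    refine Finset.sum_congr rfl fun t ht => ?_
    have h1 : s t k = j := (hs t (Fin.last k)).trans (Finset.mem_filter.1 ht).2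
    have h2 : s t (k + 1) = i := by simp [s]
    rw [hmarkov _ (hS t) k hk (s t), h1, h2, mul_comm]

theorem IsInitialCondition.isMarkovFor {ι : Type*} [Fintype ι] {x : Ω → ι → ℝ}
    (hP : ∀ i j, 0 ≤ P i j) (hθ : ∀ k, Measurable (θ k))
    (hx : IsInitialCondition Pr P θ k₀ x) :
    IsMarkovFor Pr P (fun n => θ (k₀ + n)) (pathFiltration k₀ hx.measurable hθ) :=
  isMarkovFor_pathFiltration hP hx.measurable hθ hx.markov

theorem IsMarkovChain.isMarkovFor_of_indepFun (hP : ∀ i j, 0 ≤ P i j) (hθ : IsMarkovChain Pr P θ)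
    (k₀ : ℕ) (hx : Measurable x) (hind : IndepFun x (fun ω k => θ k ω) Pr) :
    IsMarkovFor Pr P (fun n => θ (k₀ + n)) (pathFiltration k₀ hx hθ.measurable) := by
  refine isMarkovFor_pathFiltration hP hx hθ.measurable fun S hS k _ s => ?_
  have hsplit : ∀ m, Pr {ω | x ω ∈ S ∧ ∀ l ≤ m, θ l ω = s l} =
      Pr (x ⁻¹' S) * Pr {ω | ∀ l ≤ m, θ l ω = s l} := by
    intro m
    have hT : MeasurableSet {t : ℕ → Fin N | ∀ l ≤ m, t l = s l} := by
      have : {t : ℕ → Fin N | ∀ l ≤ m, t l = s l} =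
          ⋂ l, ⋂ _ : l ≤ m, (fun t => t l) ⁻¹' {s l} := by
        ext
        simp
      rw [this]
      exact .iInter fun l => .iInter fun _ => measurable_pi_apply l (MeasurableSet.singleton _)
    exact hind.measure_inter_preimage_eq_mul _ _ hS hT
  rw [hsplit, hsplit, hθ.markov, mul_assoc]

theorem IsMarkovChain.isInitialCondition_const {ι : Type*} [Fintype ι] [IsFiniteMeasure Pr]
    (hθ : IsMarkovChain Pr P θ) (k₀ : ℕ) (v : ι → ℝ) :
    IsInitialCondition Pr P θ k₀ fun _ => v where
  measurable := measurable_const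
  memLp := memLp_const v
  markov S _ k _ s := by
    by_cases hv : v ∈ S <;> simp [hv, hθ.markov]

end MarkovFiltration

/-! ### Cross correlations and their recursions -/

section CrossCorrelation

variable {Ω : Type*} [MeasurableSpace Ω] {μ : Measure Ω} {ι κ ι' : Type*}
  {x x' : Ω → ι → ℝ} {y y' : Ω → κ → ℝ}

theorem crossCorr_transpose : (crossCorr μ x y)ᵀ = crossCorr μ y x := by
  ext i j
  simp [crossCorr, mul_comm]

variable [Fintype ι] [Fintype κ]

theorem MeasureTheory.MemLp.integrable_apply_mul_apply (hx : MemLp x 2 μ) (hy : MemLp y 2 μ)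
    (i : ι) (j : κ) : Integrable (fun ω => x ω i * y ω j) μ :=
  (hx.eval i).integrable_mul (hy.eval j)

theorem crossCorr_add_left (hx : MemLp x 2 μ) (hx' : MemLp x' 2 μ) (hy : MemLp y 2 μ) :
    crossCorr μ (fun ω => x ω + x' ω) y = crossCorr μ x y + crossCorr μ x' y := by
  ext i j
  simp only [crossCorr, Matrix.of_apply, Matrix.add_apply, Pi.add_apply, add_mul]
  exact integral_add (hx.integrable_apply_mul_apply hy i j) (hx'.integrable_apply_mul_apply hy i j)

theorem crossCorr_add_right (hx : MemLp x 2 μ) (hy : MemLp y 2 μ) (hy' : MemLp y' 2 μ) :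
    crossCorr μ x (fun ω => y ω + y' ω) = crossCorr μ x y + crossCorr μ x y' := by
  rw [← crossCorr_transpose, crossCorr_add_left hy hy' hx, Matrix.transpose_add,
    crossCorr_transpose, crossCorr_transpose]

theorem crossCorr_mulVec_left (hx : MemLp x 2 μ) (hy : MemLp y 2 μ) (A : Matrix ι' ι ℝ) :
    crossCorr μ (fun ω => A *ᵥ x ω) y = A * crossCorr μ x y := by
  ext i j
  simp only [crossCorr, Matrix.of_apply, Matrix.mul_apply, Matrix.mulVec, dotProduct,
    Finset.sum_mul, mul_assoc]
  rw [integral_finsetSum _ fun k _ => (hx.integrable_apply_mul_apply hy k j).const_mul _]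
  simp only [integral_const_mul]

theorem crossCorr_mulVec_right (hx : MemLp x 2 μ) [Fintype ι'] (hy : MemLp y 2 μ)
    (A : Matrix ι' κ ℝ) :
    crossCorr μ x (fun ω => A *ᵥ y ω) = crossCorr μ x y * Aᵀ := by
  rw [← crossCorr_transpose, crossCorr_mulVec_left hy hx, Matrix.transpose_mul,
    crossCorr_transpose]

theorem crossCorr_posSemidef (hx : MemLp x 2 μ) : (crossCorr μ x x).PosSemidef := by
  refine .of_dotProduct_mulVec_nonneg crossCorr_transpose fun w => ?_
  -- the quadratic form is the second moment of the scalar `w ⬝ᵥ x`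
  set W : Matrix Unit ι ℝ := Matrix.of fun _ => w
  have hW : MemLp (fun ω => W *ᵥ x ω) 2 μ :=
    .of_eval fun _ => memLp_finsetSum _ fun i _ => (hx.eval i).const_mul (w i)
  have h : star w ⬝ᵥ crossCorr μ x x *ᵥ w =
      crossCorr μ (fun ω => W *ᵥ x ω) (fun ω => W *ᵥ x ω) () () := by
    rw [crossCorr_mulVec_left hx hW, crossCorr_mulVec_right hx hx, ← Matrix.mul_assoc,
      Matrix.mul_assoc]
    rfl
  rw [h]
  exact integral_nonneg fun ω => mul_self_nonneg _

/-- The Cauchy-Schwarz inequality for the entries of a cross correlation. -/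
theorem sq_crossCorr_apply_le (hx : MemLp x 2 μ) (hy : MemLp y 2 μ) (i : ι) (j : κ) :
    (crossCorr μ x y i j) ^ 2 ≤ crossCorr μ x x i i * crossCorr μ y y j j := by
  have h : ∀ t : ℝ, 0 ≤ crossCorr μ y y j j * (t * t) + 2 * crossCorr μ x y i j * t +
      crossCorr μ x x i i := by
    intro t
    have hxx := hx.integrable_apply_mul_apply hx i i
    have hxy := hx.integrable_apply_mul_apply hy i j
    have hyy := hy.integrable_apply_mul_apply hy j j
    have : ∫ ω, (t * y ω j + x ω i) ^ 2 ∂μ = crossCorr μ y y j j * (t * t) +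
        2 * crossCorr μ x y i j * t + crossCorr μ x x i i := by
      have h1 := integral_add ((hyy.mul_const (t * t)).add ((hxy.const_mul 2).mul_const t)) hxx
      have h2 := integral_add (hyy.mul_const (t * t)) ((hxy.const_mul 2).mul_const t)
      simp only [Pi.add_apply, integral_mul_const, integral_const_mul] at h1 h2
      simp only [crossCorr, Matrix.of_apply]
      rw [← h2, ← h1]
      congr 1
      ext ω
      ring
    rw [← this]
    exact integral_nonneg fun ω => sq_nonneg _
  have := discrim_le_zero h
  rw [discrim] at this
  nlinarith

end CrossCorrelation

section JumpRecursion

variable {N : ℕ} {Ω : Type*} {ι κ ι' : Type*}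

theorem measurable_mulVec_comp [Fintype κ] {m : MeasurableSpace Ω} {t : Ω → Fin N} {f : Ω → κ → ℝ}
    (ht : Measurable[m] t) (hf : Measurable[m] f) (A : Fin N → Matrix ι κ ℝ) :
    Measurable[m] fun ω => A (t ω) *ᵥ f ω := by
  refine measurable_pi_lambda _ fun u => ?_
  refine Finset.measurable_fun_sum _ fun v _ => ?_
  exact ((measurable_of_finite fun j => A j u v).comp ht).mul ((measurable_pi_apply v).comp hf)

/-- The solution of `X (n + 1) = J_{θ n} X n + B_{θ n} η n` with `X 0 = x`. -/
def jumpTraj [Fintype ι] [Fintype κ] (J : Fin N → Matrix ι ι ℝ) (B : Fin N → Matrix ι κ ℝ)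
    (θ : ℕ → Ω → Fin N) (η : ℕ → Ω → κ → ℝ) (x : Ω → ι → ℝ) : ℕ → Ω → ι → ℝ
  | 0 => x
  | n + 1 => fun ω => J (θ n ω) *ᵥ jumpTraj J B θ η x n ω + B (θ n ω) *ᵥ η n ω

variable [Fintype ι] [Fintype κ] [Fintype ι']
  {J : Fin N → Matrix ι ι ℝ} {B : Fin N → Matrix ι κ ℝ} {θ : ℕ → Ω → Fin N}
  {η : ℕ → Ω → κ → ℝ} {x : Ω → ι → ℝ}

theorem jumpTraj_eq_add (n : ℕ) (ω : Ω) : jumpTraj J B θ η x n ω =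
    jumpTraj J B θ 0 x n ω + jumpTraj J B θ η 0 n ω := by
  induction n with
  | zero => simp [jumpTraj]
  | succ n ih => simp [jumpTraj, ih, Matrix.mulVec_add, add_assoc]

theorem jumpTraj_zero_neg (n : ℕ) (ω : Ω) :
    jumpTraj J B θ 0 (fun ω => -x ω) n ω = -jumpTraj J B θ 0 x n ω := by
  induction n with
  | zero => simp [jumpTraj]
  | succ n ih => simp [jumpTraj, ih, Matrix.mulVec_neg]

variable [mΩ : MeasurableSpace Ω] {Pr : Measure Ω} {P : Matrix (Fin N) (Fin N) ℝ}
  {𝓖 : Filtration ℕ mΩ}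

theorem memLp_mulVec_comp {t : Ω → Fin N} {f : Ω → κ → ℝ} (ht : Measurable t)
    (hf : MemLp f 2 Pr) (A : Fin N → Matrix ι κ ℝ) : MemLp (fun ω => A (t ω) *ᵥ f ω) 2 Pr := by
  refine .of_eval fun u => memLp_finsetSum _ fun v _ => ?_
  refine (hf.eval v).of_le_mul (c := ∑ j, |A j u v|) ?_ (.of_forall fun ω => ?_)
  · exact ((measurable_of_finite fun j => A j u v).comp ht).aestronglyMeasurable.mul
      (hf.eval v).aestronglyMeasurable
  · rw [norm_mul]
    refine mul_le_mul_of_nonneg_right ?_ (norm_nonneg _)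
    exact Finset.single_le_sum (f := fun j => |A j u v|) (fun _ _ => abs_nonneg _)
      (Finset.mem_univ (t ω))

theorem IsMarkovFor.measurable_jumpTraj (h : IsMarkovFor Pr P θ 𝓖) (hx : Measurable[𝓖 0] x)
    (hη : ∀ n, Measurable[𝓖 n] (η n)) (n : ℕ) : Measurable[𝓖 n] (jumpTraj J B θ η x n) := by
  induction n with
  | zero => exact hx
  | succ n ih =>
    refine Measurable.mono ?_ (𝓖.mono n.le_succ) le_rfl
    exact (measurable_mulVec_comp (h.adapted n) ih J).add
      (measurable_mulVec_comp (h.adapted n) (hη n) B)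

theorem memLp_jumpTraj (hθ : ∀ n, Measurable (θ n)) (hx : MemLp x 2 Pr)
    (hη : ∀ n, MemLp (η n) 2 Pr) (n : ℕ) : MemLp (jumpTraj J B θ η x n) 2 Pr := by
  induction n with
  | zero => exact hx
  | succ n ih => exact (memLp_mulVec_comp (hθ n) ih J).add (memLp_mulVec_comp (hθ n) (hη n) B)

/-- The part of the cross correlation `E[f gᵀ]` carried by the event that the mode at time `n` is
`j`. -/
noncomputable def modeCorr (Pr : Measure Ω) (θ : ℕ → Ω → Fin N) (n : ℕ) (j : Fin N)
    (f : Ω → ι → ℝ) (g : Ω → κ → ℝ) : Matrix ι κ ℝ :=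
  crossCorr (Pr.restrict (θ n ⁻¹' {j})) f g

theorem IsMarkovFor.sum_modeCorr (h : IsMarkovFor Pr P θ 𝓖) {f : Ω → ι → ℝ} {g : Ω → κ → ℝ}
    (hf : MemLp f 2 Pr) (hg : MemLp g 2 Pr) (n : ℕ) :
    ∑ j, modeCorr Pr θ n j f g = crossCorr Pr f g := by
  ext u v
  rw [Matrix.sum_apply]
  exact h.sum_setIntegral n (hf.integrable_apply_mul_apply hg u v)

theorem IsMarkovFor.modeCorr_succ (h : IsMarkovFor Pr P θ 𝓖) {n : ℕ} {f : Fin N → Ω → ι → ℝ}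
    {g : Fin N → Ω → κ → ℝ} (hfm : ∀ j, Measurable[𝓖 n] (f j)) (hgm : ∀ j, Measurable[𝓖 n] (g j))
    (hf : ∀ j, MemLp (f j) 2 Pr) (hg : ∀ j, MemLp (g j) 2 Pr) (i : Fin N) :
    modeCorr Pr θ (n + 1) i (fun ω => f (θ n ω) ω) (fun ω => g (θ n ω) ω) =
      ∑ j, P j i • modeCorr Pr θ n j (f j) (g j) := by
  ext u v
  rw [Matrix.sum_apply]
  exact h.setIntegral_succ (F := fun j ω => f j ω u * g j ω v)
    (fun j => ((measurable_pi_apply u).comp (hfm j)).mul ((measurable_pi_apply v).comp (hgm j)))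
    (fun j => (hf j).integrable_apply_mul_apply (hg j) u v) i

theorem IsMarkovFor.modeCorr_jumpTraj_left (h : IsMarkovFor Pr P θ 𝓖) (hx : Measurable[𝓖 0] x)
    (hη : ∀ n, Measurable[𝓖 n] (η n)) (hx2 : MemLp x 2 Pr) (hη2 : ∀ n, MemLp (η n) 2 Pr)
    {y : Ω → ι' → ℝ} (n : ℕ) (hy : Measurable[𝓖 n] y) (hy2 : MemLp y 2 Pr) (i : Fin N) :
    modeCorr Pr θ (n + 1) i (jumpTraj J B θ η x (n + 1)) y =
      ∑ j, P j i • (J j * modeCorr Pr θ n j (jumpTraj J B θ η x n) y +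
        B j * modeCorr Pr θ n j (η n) y) := by
  have hθ : ∀ n, Measurable (θ n) := fun n => (h.adapted n).mono (𝓖.le n) le_rfl
  have hX2 := memLp_jumpTraj (J := J) (B := B) hθ hx2 hη2 n
  have hXm := h.measurable_jumpTraj (J := J) (B := B) hx hη n
  have hJ : ∀ j, MemLp (fun ω => J j *ᵥ jumpTraj J B θ η x n ω) 2 Pr := fun j =>
    memLp_mulVec_comp (t := fun _ => j) measurable_const hX2 J
  have hB : ∀ j, MemLp (fun ω => B j *ᵥ η n ω) 2 Pr := fun j =>
    memLp_mulVec_comp (t := fun _ => j) measurable_const (hη2 n) B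
  have := h.modeCorr_succ (f := fun j ω => J j *ᵥ jumpTraj J B θ η x n ω + B j *ᵥ η n ω)
    (g := fun _ => y) (fun j =>
      (measurable_mulVec_comp (t := fun _ => j) measurable_const hXm J).add
        (measurable_mulVec_comp (t := fun _ => j) measurable_const (hη n) B))
    (fun _ => hy) (fun j => (hJ j).add (hB j)) (fun _ => hy2) i
  refine this.trans (Finset.sum_congr rfl fun j _ => ?_)
  simp only [modeCorr]
  rw [crossCorr_add_left ((hJ j).restrict _) ((hB j).restrict _) (hy2.restrict _),
    crossCorr_mulVec_left (hX2.restrict _) (hy2.restrict _),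
    crossCorr_mulVec_left ((hη2 n).restrict _) (hy2.restrict _)]

theorem IsMarkovFor.modeCorr_jumpTraj_self (h : IsMarkovFor Pr P θ 𝓖) (hx : Measurable[𝓖 0] x)
    (hη : ∀ n, Measurable[𝓖 n] (η n)) (hx2 : MemLp x 2 Pr) (hη2 : ∀ n, MemLp (η n) 2 Pr)
    (n : ℕ) (i : Fin N) :
    modeCorr Pr θ (n + 1) i (jumpTraj J B θ η x (n + 1)) (jumpTraj J B θ η x (n + 1)) =
      ∑ j, P j i • (J j *
          modeCorr Pr θ n j (jumpTraj J B θ η x n) (jumpTraj J B θ η x n) * (J j)ᵀ +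
        (B j * modeCorr Pr θ n j (η n) (η n) * (B j)ᵀ +
          J j * modeCorr Pr θ n j (jumpTraj J B θ η x n) (η n) * (B j)ᵀ +
          B j * (modeCorr Pr θ n j (jumpTraj J B θ η x n) (η n))ᵀ * (J j)ᵀ)) := by
  have hθ : ∀ n, Measurable (θ n) := fun n => (h.adapted n).mono (𝓖.le n) le_rfl
  have hX2 := memLp_jumpTraj (J := J) (B := B) hθ hx2 hη2 n
  have hXm := h.measurable_jumpTraj (J := J) (B := B) hx hη n
  have hJ : ∀ j, MemLp (fun ω => J j *ᵥ jumpTraj J B θ η x n ω) 2 Pr := fun j =>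
    memLp_mulVec_comp (t := fun _ => j) measurable_const hX2 J
  have hB : ∀ j, MemLp (fun ω => B j *ᵥ η n ω) 2 Pr := fun j =>
    memLp_mulVec_comp (t := fun _ => j) measurable_const (hη2 n) B
  have hm : ∀ j, Measurable[𝓖 n] fun ω => J j *ᵥ jumpTraj J B θ η x n ω + B j *ᵥ η n ω := fun j =>
    (measurable_mulVec_comp (t := fun _ => j) measurable_const hXm J).add
      (measurable_mulVec_comp (t := fun _ => j) measurable_const (hη n) B)
  have h2 : ∀ j, MemLp (fun ω => J j *ᵥ jumpTraj J B θ η x n ω + B j *ᵥ η n ω) 2 Pr := fun j =>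
    (hJ j).add (hB j)
  have := h.modeCorr_succ (f := fun j ω => J j *ᵥ jumpTraj J B θ η x n ω + B j *ᵥ η n ω)
    (g := fun j ω => J j *ᵥ jumpTraj J B θ η x n ω + B j *ᵥ η n ω) hm hm h2 h2 i
  refine this.trans (Finset.sum_congr rfl fun j _ => ?_)
  simp only [modeCorr, crossCorr_transpose]
  rw [crossCorr_add_left ((hJ j).restrict _) ((hB j).restrict _) ((h2 j).restrict _),
    crossCorr_add_right ((hJ j).restrict _) ((hJ j).restrict _) ((hB j).restrict _),
    crossCorr_add_right ((hB j).restrict _) ((hJ j).restrict _) ((hB j).restrict _),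
    crossCorr_mulVec_left (hX2.restrict _) ((hJ j).restrict _),
    crossCorr_mulVec_left (hX2.restrict _) ((hB j).restrict _),
    crossCorr_mulVec_left ((hη2 n).restrict _) ((hJ j).restrict _),
    crossCorr_mulVec_left ((hη2 n).restrict _) ((hB j).restrict _),
    crossCorr_mulVec_right (hX2.restrict _) (hX2.restrict _),
    crossCorr_mulVec_right (hX2.restrict _) ((hη2 n).restrict _),
    crossCorr_mulVec_right ((hη2 n).restrict _) (hX2.restrict _),
    crossCorr_mulVec_right ((hη2 n).restrict _) ((hη2 n).restrict _)]
  simp only [← Matrix.mul_assoc]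
  congr 1
  abel

end JumpRecursion

/-! ### The homogeneous system -/

section MomentLimits

variable {Ω : Type*} [mΩ : MeasurableSpace Ω] {Pr : Measure Ω} {ι κ : Type*}

theorem crossCorr_zero_right (x : Ω → ι → ℝ) : crossCorr Pr x (0 : Ω → κ → ℝ) = 0 := by
  ext
  simp [crossCorr]

theorem crossCorr_zero_left (y : Ω → κ → ℝ) : crossCorr Pr (0 : Ω → ι → ℝ) y = 0 := by
  ext
  simp [crossCorr]

theorem crossCorr_one_apply (x : Ω → ι → ℝ) (u : ι) :
    crossCorr Pr x (fun _ (_ : Unit) => 1) u () = meanVec Pr x u := by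
  simp [crossCorr, meanVec]

variable [Fintype ι]

theorem crossCorr_parallelogram {z w : Ω → ι → ℝ} (hz : MemLp z 2 Pr) (hw : MemLp w 2 Pr) :
    crossCorr Pr (fun ω => z ω + w ω) (fun ω => z ω + w ω) +
        crossCorr Pr (fun ω => -z ω + w ω) (fun ω => -z ω + w ω) =
      (2 : ℝ) • (crossCorr Pr z z + crossCorr Pr w w) := by
  have hz' : MemLp (fun ω => -z ω) 2 Pr := hz.neg
  have hl : ∀ y : Ω → ι → ℝ, crossCorr Pr (fun ω => -z ω) y = -crossCorr Pr z y := fun y => by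
    ext
    simp [crossCorr, integral_neg]
  have hr : ∀ y : Ω → ι → ℝ, crossCorr Pr y (fun ω => -z ω) = -crossCorr Pr y z := fun y => by
    ext
    simp [crossCorr, integral_neg]
  rw [crossCorr_add_left (y := fun ω => z ω + w ω) hz hw (hz.add hw),
    crossCorr_add_right hz hz hw, crossCorr_add_right hw hz hw,
    crossCorr_add_left (y := fun ω => -z ω + w ω) hz' hw (hz'.add hw),
    crossCorr_add_right hz' hz' hw, crossCorr_add_right hw hz' hw, hl, hl, hr, hr, two_smul]
  abel

/-- By the Cauchy-Schwarz inequality, a perturbation that vanishes in mean square does not change the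
limit of the second moments, however it is correlated with the rest. -/
theorem tendsto_crossCorr_add_of_tendsto_zero {z w : ℕ → Ω → ι → ℝ} {Q : Matrix ι ι ℝ}
    (hz : ∀ n, MemLp (z n) 2 Pr) (hw : ∀ n, MemLp (w n) 2 Pr)
    (hz0 : Tendsto (fun n => crossCorr Pr (z n) (z n)) atTop (𝓝 0))
    (hwQ : Tendsto (fun n => crossCorr Pr (w n) (w n)) atTop (𝓝 Q)) :
    Tendsto (fun n => crossCorr Pr (fun ω => z n ω + w n ω) (fun ω => z n ω + w n ω)) atTop
      (𝓝 Q) := by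
  have hzw : Tendsto (fun n => crossCorr Pr (z n) (w n)) atTop (𝓝 0) := by
    refine tendsto_pi_nhds.2 fun u => tendsto_pi_nhds.2 fun v => ?_
    have h := (tendsto_pi_nhds.1 (tendsto_pi_nhds.1 hz0 u) u).mul
      (tendsto_pi_nhds.1 (tendsto_pi_nhds.1 hwQ v) v)
    simp only [Matrix.zero_apply, zero_mul] at h
    have h2 := (squeeze_zero (fun n => sq_nonneg _)
      (fun n => sq_crossCorr_apply_le (hz n) (hw n) u v) h).sqrt
    simp only [Real.sqrt_sq_eq_abs, Real.sqrt_zero] at h2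
    exact (tendsto_zero_iff_abs_tendsto_zero _).2 h2
  have hwz : Tendsto (fun n => crossCorr Pr (w n) (z n)) atTop (𝓝 0) := by
    refine tendsto_pi_nhds.2 fun u => tendsto_pi_nhds.2 fun v => ?_
    have h := tendsto_pi_nhds.1 (tendsto_pi_nhds.1 hzw v) u
    refine h.congr fun n => ?_
    rw [← crossCorr_transpose, Matrix.transpose_apply]
  have h := (hz0.add hzw).add (hwz.add hwQ)
  rw [add_zero, zero_add, zero_add] at h
  refine h.congr fun n => ?_
  rw [crossCorr_add_left (y := fun ω => z n ω + w n ω) (hz n) (hw n) ((hz n).add (hw n)),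
    crossCorr_add_right (hz n) (hz n) (hw n), crossCorr_add_right (hw n) (hz n) (hw n)]

theorem tendsto_meanVec_of_tendsto_crossCorr_zero [IsProbabilityMeasure Pr] {z : ℕ → Ω → ι → ℝ}
    (hz : ∀ n, MemLp (z n) 2 Pr)
    (hz0 : Tendsto (fun n => crossCorr Pr (z n) (z n)) atTop (𝓝 0)) :
    Tendsto (fun n => meanVec Pr (z n)) atTop (𝓝 0) := by
  refine tendsto_pi_nhds.2 fun u => ?_
  have h2 := (squeeze_zero (fun n => sq_nonneg (meanVec Pr (z n) u)) (fun n => ?_)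
    (tendsto_pi_nhds.1 (tendsto_pi_nhds.1 hz0 u) u)).sqrt
  · simp only [Real.sqrt_sq_eq_abs, Real.sqrt_zero] at h2
    exact (tendsto_zero_iff_abs_tendsto_zero _).2 h2
  · have h := sq_crossCorr_apply_le (hz n)
      (memLp_const (fun _ : Unit => (1 : ℝ)) : MemLp (fun _ : Ω => fun _ : Unit => (1 : ℝ)) 2 Pr)
      u ()
    rw [crossCorr_one_apply] at h
    simpa [crossCorr] using h

theorem meanVec_add {x y : Ω → ι → ℝ} [IsFiniteMeasure Pr] (hx : MemLp x 2 Pr)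
    (hy : MemLp y 2 Pr) : meanVec Pr (fun ω => x ω + y ω) = meanVec Pr x + meanVec Pr y := by
  ext u
  exact integral_add ((hx.eval u).integrable one_le_two) ((hy.eval u).integrable one_le_two)

end MomentLimits

section HomogeneousSystem

variable {nb nr N : ℕ} {Ω : Type*} [mΩ : MeasurableSpace Ω] {Pr : Measure Ω}
  (G : Fin N → WeightedGraph nb nr) {P : Matrix (Fin N) (Fin N) ℝ} {θ : ℕ → Ω → Fin N}
  {𝓖 : Filtration ℕ mΩ} {η : ℕ → Ω → NoiseIdx nb nr → ℝ} {x : Ω → Fin nb → ℝ}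

/-- The trajectory of the error system with noise `η`, started at time `0` from `x`. -/
noncomputable abbrev errorTraj (θ : ℕ → Ω → Fin N) (η : ℕ → Ω → NoiseIdx nb nr → ℝ)
    (x : Ω → Fin nb → ℝ) : ℕ → Ω → Fin nb → ℝ :=
  jumpTraj (fun j => (G j).Jb) (fun j => (G j).Bb) θ η x

theorem IsMarkovFor.measurable (h : IsMarkovFor Pr P θ 𝓖) (n : ℕ) : Measurable (θ n) :=
  (h.adapted n).mono (𝓖.le n) le_rfl

theorem memLp_errorTraj (hθ : ∀ n, Measurable (θ n)) (hx : MemLp x 2 Pr)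
    (hη : ∀ n, MemLp (η n) 2 Pr) (n : ℕ) : MemLp (errorTraj G θ η x n) 2 Pr :=
  memLp_jumpTraj hθ hx hη n

/-- Without noise the second moments, split by mode and stacked, evolve by `calD`. -/
theorem hatPhi_modeCorr_homogeneous (h : IsMarkovFor Pr P θ 𝓖) (hx : Measurable[𝓖 0] x)
    (hx2 : MemLp x 2 Pr) (n m : ℕ) :
    hatPhi N nb (fun i =>
        modeCorr Pr θ (n + m) i (errorTraj G θ 0 x (n + m)) (errorTraj G θ 0 x (n + m))) =
      calD G P ^ m *ᵥ
        hatPhi N nb fun i => modeCorr Pr θ n i (errorTraj G θ 0 x n) (errorTraj G θ 0 x n) := by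
  induction m with
  | zero => simp
  | succ m ih =>
    rw [pow_succ', ← Matrix.mulVec_mulVec, ← ih, calD_mulVec_hatPhi]
    congr 1
    ext1 i
    rw [← add_assoc, errorTraj, h.modeCorr_jumpTraj_self (η := 0) hx
      (fun _ => measurable_const) hx2 (fun _ => MemLp.zero)]
    simp only [modeCorr, Pi.zero_apply, crossCorr_zero_right]
    simp

theorem tendsto_crossCorr_homogeneous (h : IsMarkovFor Pr P θ 𝓖) (hx : Measurable[𝓖 0] x)
    (hx2 : MemLp x 2 Pr) (hD : rho (calD G P) < 1) :
    Tendsto (fun n => crossCorr Pr (errorTraj G θ 0 x n) (errorTraj G θ 0 x n)) atTop (𝓝 0) := by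
  refine tendsto_pi_nhds.2 fun u => tendsto_pi_nhds.2 fun v => ?_
  have hlim := tendsto_pow_mulVec_of_rho_lt_one hD
    (hatPhi N nb fun i => modeCorr Pr θ 0 i (errorTraj G θ 0 x 0) (errorTraj G θ 0 x 0))
  have hsum := tendsto_finsetSum (Finset.univ : Finset (Fin N)) fun i _ =>
    tendsto_pi_nhds.1 hlim (i, (v, u))
  simp only [Pi.zero_apply, Finset.sum_const_zero] at hsum
  refine hsum.congr fun n => ?_
  have hz := memLp_errorTraj G (η := 0) h.measurable hx2 (fun _ => MemLp.zero) n
  rw [← h.sum_modeCorr hz hz n, Matrix.sum_apply]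
  refine Finset.sum_congr rfl fun i _ => ?_
  rw [← hatPhi_modeCorr_homogeneous G h hx hx2 0 n]
  simp only [zero_add]
  rfl

theorem errorTraj_homogeneous_pos {Ω : Type*} {θ : ℕ → Ω → Fin N} {x : Ω → Fin nb → ℝ}
    (hx : ∀ ω u, 0 < x ω u) (n : ℕ) (ω : Ω) (u : Fin nb) :
    0 < errorTraj G θ 0 x n ω u := by
  induction n generalizing u with
  | zero => exact hx ω u
  | succ n ih => simpa [jumpTraj] using (G (θ n ω)).Jb_mulVec_pos ih u

/-- Since the `Jb` are nonnegative with positive diagonal, a positive initial vector stays positive,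
and once all modes have positive probability its second moments form a positive vector, on which
decay of the powers of the nonnegative matrix `calD` can be tested. -/
theorem rho_calD_lt_one_of_tendsto [IsProbabilityMeasure Pr] (h : IsMarkovFor Pr P θ 𝓖)
    (hP : IsErgodicTransition P) (hx : Measurable[𝓖 0] x) (hx2 : MemLp x 2 Pr)
    (hpos : ∀ ω u, 0 < x ω u)
    (hlim : Tendsto (fun n => crossCorr Pr (errorTraj G θ 0 x n) (errorTraj G θ 0 x n)) atTop
      (𝓝 0)) : rho (calD G P) < 1 := by
  obtain ⟨n₁, hn₁⟩ := h.exists_forall_real_preimage_pos hP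
  have hz := memLp_errorTraj G (η := 0) h.measurable hx2 (fun _ => MemLp.zero)
  have hzpos := errorTraj_homogeneous_pos G (θ := θ) hpos
  refine rho_lt_one_of_tendsto_pow_mulVec (calD_nonneg G h.nonneg)
    (v := hatPhi N nb fun i => modeCorr Pr θ n₁ i (errorTraj G θ 0 x n₁) (errorTraj G θ 0 x n₁))
    ?_ ?_
  · rintro ⟨i, c, r⟩
    change 0 < ∫ ω in θ n₁ ⁻¹' {i}, errorTraj G θ 0 x n₁ ω r * errorTraj G θ 0 x n₁ ω c ∂Pr
    rw [setIntegral_pos_iff_support_of_nonneg_ae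
      (.of_forall fun ω => (mul_pos (hzpos _ _ _) (hzpos _ _ _)).le)
      ((hz n₁).integrable_apply_mul_apply (hz n₁) r c).integrableOn]
    have : (Function.support fun ω =>
        errorTraj G θ 0 x n₁ ω r * errorTraj G θ 0 x n₁ ω c) = Set.univ :=
      Set.eq_univ_of_forall fun ω => (mul_pos (hzpos _ _ _) (hzpos _ _ _)).ne'
    rw [this, Set.univ_inter]
    exact (ENNReal.toReal_pos_iff.1 (hn₁ i)).1
  · refine tendsto_pi_nhds.2 ?_
    rintro ⟨i, c, r⟩
    have hsub := tendsto_pi_nhds.1 (tendsto_pi_nhds.1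
      ((tendsto_add_atTop_iff_nat n₁).2 hlim) r) c
    refine squeeze_zero (fun m => ?_) (fun m => ?_) hsub
    · rw [← hatPhi_modeCorr_homogeneous G h hx hx2]
      exact integral_nonneg fun ω => (mul_pos (hzpos _ _ _) (hzpos _ _ _)).le
    · rw [← hatPhi_modeCorr_homogeneous G h hx hx2, add_comm n₁ m]
      exact setIntegral_le_integral ((hz _).integrable_apply_mul_apply (hz _) r c)
        (.of_forall fun ω => (mul_pos (hzpos _ _ _) (hzpos _ _ _)).le)

end HomogeneousSystem

/-! ### The response to the noise -/

section NoiseResponse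

variable {nb nr N : ℕ} {Ω : Type*} [mΩ : MeasurableSpace Ω] {Pr : Measure Ω}
  (G : Fin N → WeightedGraph nb nr) {P : Matrix (Fin N) (Fin N) ℝ} {θ : ℕ → Ω → Fin N}
  {𝓖 : Filtration ℕ mΩ} {η : ℕ → Ω → NoiseIdx nb nr → ℝ} {ι : Type*}

theorem psi_smul (p : Fin N → ℝ) (c : ℝ) (g : NoiseIdx nb nr → ℝ) :
    psi G P p (c • g) = c • psi G P p g := by
  ext a
  simp only [psi, Finset.sum_apply, Pi.smul_apply, smul_eq_mul, Matrix.mulVec_smul, Finset.mul_sum]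
  exact Finset.sum_congr rfl fun i _ => by ring

theorem continuous_psi (g : NoiseIdx nb nr → ℝ) : Continuous fun p => psi G P p g := by
  refine continuous_pi fun a => ?_
  simp only [psi, Finset.sum_apply, Pi.smul_apply, smul_eq_mul]
  fun_prop

theorem exists_abs_psi_le (hP : ∀ i j, 0 ≤ P i j) {K : ℝ} (hK : 0 ≤ K) :
    ∃ K', ∀ (p : Fin N → ℝ) (g : NoiseIdx nb nr → ℝ), (∀ i, |p i| ≤ 1) → (∀ s, |g s| ≤ K) →
      ∀ a, |psi G P p g a| ≤ K' := by
  refine ⟨∑ a : Fin N × Fin nb, ∑ i, P i a.1 * ∑ s, |(G i).Bb a.2 s| * K, fun p g hp hg a => ?_⟩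
  have hnn : ∀ a : Fin N × Fin nb, 0 ≤ ∑ i, P i a.1 * ∑ s, |(G i).Bb a.2 s| * K := fun a =>
    Finset.sum_nonneg fun i _ => mul_nonneg (hP _ _) (Finset.sum_nonneg fun s _ => by positivity)
  refine le_trans ?_ (Finset.single_le_sum (fun a _ => hnn a) (Finset.mem_univ a))
  simp only [psi, Finset.sum_apply, Pi.smul_apply, smul_eq_mul]
  refine (Finset.abs_sum_le_sum_abs _ _).trans (Finset.sum_le_sum fun i _ => ?_)
  rw [abs_mul, abs_mul, abs_of_nonneg (hP _ _)]
  refine mul_le_mul (mul_le_of_le_one_right (hP _ _) (hp i)) ?_ (abs_nonneg _) (hP _ _)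
  refine (Finset.abs_sum_le_sum_abs _ _).trans (Finset.sum_le_sum fun s _ => ?_)
  rw [abs_mul]
  exact mul_le_mul_of_nonneg_left (hg s) (abs_nonneg _)

/-- Column `v` of the correlations with `y` of the response to the noise `η` from zero initial state,
split by the current mode and stacked over the modes. -/
noncomputable def noiseCorr (Pr : Measure Ω) (θ : ℕ → Ω → Fin N)
    (η : ℕ → Ω → NoiseIdx nb nr → ℝ) (y : Ω → ι → ℝ) (v : ι) (n : ℕ) : Fin N × Fin nb → ℝ :=
  fun a => modeCorr Pr θ n a.1 (errorTraj G θ η 0 n) y a.2 v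

theorem noiseCorr_zero (y : Ω → ι → ℝ) (v : ι) : noiseCorr G Pr θ η y v 0 = 0 := by
  ext a
  simp [noiseCorr, modeCorr, errorTraj, jumpTraj, crossCorr_zero_left]

variable [Fintype ι]

/-- The vector `y` is known from the start, and its correlations with the noise `η` are the same
given any mode at any time. -/
structure IsModeFree (Pr : Measure Ω) (θ : ℕ → Ω → Fin N) (𝓖 : Filtration ℕ mΩ)
    (η : ℕ → Ω → NoiseIdx nb nr → ℝ) (y : Ω → ι → ℝ) : Prop where
  measurable : Measurable[𝓖 0] y
  memLp : MemLp y 2 Pr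
  modeCorr_eq : ∀ n j k, modeCorr Pr θ n j (η k) y = Pr.real (θ n ⁻¹' {j}) • crossCorr Pr (η k) y

theorem noiseCorr_succ (h : IsMarkovFor Pr P θ 𝓖) (hη : ∀ n, Measurable[𝓖 0] (η n))
    (hη2 : ∀ n, MemLp (η n) 2 Pr) {y : Ω → ι → ℝ} (hy : IsModeFree Pr θ 𝓖 η y) (v : ι) (n : ℕ) :
    noiseCorr G Pr θ η y v (n + 1) = calC G P *ᵥ noiseCorr G Pr θ η y v n +
      psi G P (fun i => Pr.real (θ n ⁻¹' {i})) fun s => crossCorr Pr (η n) y s v := by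
  ext ⟨i, u⟩
  have hmono : ∀ n, 𝓖 0 ≤ 𝓖 n := fun n => 𝓖.mono n.zero_le
  have hrec := h.modeCorr_jumpTraj_left (J := fun j => (G j).Jb) (B := fun j => (G j).Bb) (x := 0)
    measurable_const (fun n => (hη n).mono (hmono n) le_rfl) MemLp.zero hη2 n
    (hy.measurable.mono (hmono n) le_rfl) hy.memLp i
  rw [Pi.add_apply, calC_mulVec_apply]
  have := congrFun (congrFun hrec u) v
  refine this.trans ?_
  rw [Matrix.sum_apply]
  simp only [psi, Finset.sum_apply, ← Finset.sum_add_distrib]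
  refine Finset.sum_congr rfl fun j _ => ?_
  rw [hy.modeCorr_eq]
  simp only [Matrix.smul_apply, Matrix.add_apply, Matrix.mul_smul, smul_eq_mul, mul_add,
    Pi.smul_apply]
  rw [← mul_assoc]
  rfl

/-- The limit for a fixed `y` with constant correlations `g` with the noise; `y = 1` gives the means. -/
theorem tendsto_noiseCorr (h : IsMarkovFor Pr P θ 𝓖) (hη : ∀ n, Measurable[𝓖 0] (η n))
    (hη2 : ∀ n, MemLp (η n) 2 Pr) {y : Ω → ι → ℝ} (hy : IsModeFree Pr θ 𝓖 η y)
    (hC : rho (calC G P) < 1) {π : Fin N → ℝ}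
    (hp : ∀ i, Tendsto (fun n => Pr.real (θ n ⁻¹' {i})) atTop (𝓝 (π i)))
    {g : NoiseIdx nb nr → ℝ} {v : ι} (hg : ∀ n s, crossCorr Pr (η n) y s v = g s) :
    Tendsto (noiseCorr G Pr θ η y v) atTop (𝓝 ((1 - calC G P)⁻¹ *ᵥ psi G P π g)) := by
  refine tendsto_of_affine_recursion hC (noiseCorr_succ G h hη hη2 hy v) ?_
  simp only [hg]
  exact ((continuous_psi G g).tendsto π).comp (tendsto_pi_nhds.2 hp)

/-- For noise that is uncorrelated in time, the response up to time `n` is correlated with the noise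
at time `n` only through the means. -/
theorem noiseCorr_eq_smul_of_isWhite (h : IsMarkovFor Pr P θ 𝓖)
    (hη : ∀ n, Measurable[𝓖 0] (η n)) (hη2 : ∀ n, MemLp (η n) 2 Pr)
    (hfree : ∀ m, IsModeFree Pr θ 𝓖 η (η m))
    (hone : IsModeFree Pr θ 𝓖 η fun _ (_ : Unit) => (1 : ℝ)) {γ : NoiseIdx nb nr → ℝ}
    (hγ : ∀ n, meanVec Pr (η n) = γ) (hwhite : IsWhite Pr η γ) (m : ℕ) (v : NoiseIdx nb nr)
    (n : ℕ) (hn : n ≤ m) :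
    noiseCorr G Pr θ η (η m) v n = γ v • noiseCorr G Pr θ η (fun _ (_ : Unit) => (1 : ℝ)) () n := by
  induction n with
  | zero => simp [noiseCorr_zero]
  | succ n ih =>
    rw [noiseCorr_succ G h hη hη2 (hfree m), noiseCorr_succ G h hη hη2 hone, ih (by omega),
      Matrix.mulVec_smul, smul_add, ← psi_smul]
    congr 2
    ext s
    rw [hwhite n m (by omega), Pi.smul_apply, crossCorr_one_apply, hγ]
    simp [Matrix.vecMulVec_apply, mul_comm]

/-- For wide sense stationary noise the correlations of the response with the current noise are
convolutions of powers of `calC` with the lag correlations of the noise, hence convergent. -/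
theorem exists_tendsto_noiseCorr [IsProbabilityMeasure Pr] (h : IsMarkovFor Pr P θ 𝓖)
    (hη : ∀ n, Measurable[𝓖 0] (η n))
    (hη2 : ∀ n, MemLp (η n) 2 Pr) (hfree : ∀ m, IsModeFree Pr θ 𝓖 η (η m))
    (hC : rho (calC G P) < 1) {π : Fin N → ℝ}
    (hp : ∀ i, Tendsto (fun n => Pr.real (θ n ⁻¹' {i})) atTop (𝓝 (π i)))
    {Γ : Matrix (NoiseIdx nb nr) (NoiseIdx nb nr) ℝ} (hΓ : ∀ n, crossCorr Pr (η n) (η n) = Γ)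
    (hshift : ∀ k l m, crossCorr Pr (η (k + m)) (η (l + m)) = crossCorr Pr (η k) (η l))
    (v : NoiseIdx nb nr) :
    ∃ S, Tendsto (fun n => noiseCorr G Pr θ η (η n) v n) atTop (𝓝 S) := by
  set g : ℕ → NoiseIdx nb nr → ℝ := fun m s => crossCorr Pr (η 0) (η (m + 1)) s v
  have hΓ0 : ∀ s, 0 ≤ Γ s s := fun s => by
    rw [← hΓ 0]
    exact integral_nonneg fun ω => mul_self_nonneg _
  set K := ∑ s, (1 + Γ s s * Γ v v) with hKdef
  have hterm : ∀ s, 0 ≤ 1 + Γ s s * Γ v v := fun s =>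
    add_nonneg zero_le_one (mul_nonneg (hΓ0 s) (hΓ0 v))
  have hK : 0 ≤ K := Finset.sum_nonneg fun s _ => hterm s
  have hgK : ∀ m s, |g m s| ≤ K := by
    intro m s
    have h1 := sq_crossCorr_apply_le (hη2 0) (hη2 (m + 1)) s v
    rw [hΓ, hΓ] at h1
    have h2 : |g m s| ≤ 1 + Γ s s * Γ v v := by
      have h3 : |g m s| ^ 2 ≤ Γ s s * Γ v v := by rw [sq_abs]; exact h1
      nlinarith [sq_nonneg (|g m s| - 1), abs_nonneg (g m s)]
    exact h2.trans (Finset.single_le_sum (fun s _ => hterm s) (Finset.mem_univ s))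
  -- a bound uniform in time and lag, as dominated convergence requires
  obtain ⟨K', hK'⟩ := exists_abs_psi_le G h.nonneg hK
  have hp1 : ∀ n i, |Pr.real (θ n ⁻¹' {i})| ≤ 1 := fun n i => by
    rw [abs_of_nonneg measureReal_nonneg]
    exact measureReal_le_one
  have hlim := tendsto_sum_pow_mulVec hC
    (V := fun n m => psi G P (fun i => Pr.real (θ (n - 1 - m) ⁻¹' {i})) (g m))
    (V' := fun m => psi G P π (g m)) (K := K')
    (fun n m a => hK' _ _ (hp1 _) (hgK m) a) fun m => by
      have : Tendsto (fun n => n - 1 - m) atTop atTop := by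
        simpa [Nat.sub_sub] using tendsto_sub_atTop_nat (1 + m)
      exact (((continuous_psi G (g m)).tendsto π).comp (tendsto_pi_nhds.2 hp)).comp this
  refine ⟨_, hlim.congr fun n => ?_⟩
  rw [eq_pow_mulVec_add_sum (noiseCorr_succ G h hη hη2 (hfree n) v) n, noiseCorr_zero,
    Matrix.mulVec_zero, zero_add]
  refine Finset.sum_congr rfl fun m hm => ?_
  have hmn := Finset.mem_range.1 hm
  have := hshift 0 (m + 1) (n - 1 - m)
  rw [zero_add, show m + 1 + (n - 1 - m) = n by omega] at this
  rw [this]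

/-- The forcing term in the recursion of the second moments, in terms of the mode probabilities `p`
and of the correlations `S` of response and noise. -/
noncomputable def secondForcing (P : Matrix (Fin N) (Fin N) ℝ)
    (Γ : Matrix (NoiseIdx nb nr) (NoiseIdx nb nr) ℝ) (p : Fin N → ℝ)
    (S : Fin N → Matrix (Fin nb) (NoiseIdx nb nr) ℝ) : Fin N → Matrix (Fin nb) (Fin nb) ℝ :=
  fun i => ∑ j, P j i • (p j • ((G j).Bb * Γ * (G j).Bbᵀ) + (G j).Jb * S j * (G j).Bbᵀ +
    (G j).Bb * (S j)ᵀ * (G j).Jbᵀ)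

theorem continuous_secondForcing (Γ : Matrix (NoiseIdx nb nr) (NoiseIdx nb nr) ℝ) :
    Continuous fun a : (Fin N → ℝ) × (Fin N → Matrix (Fin nb) (NoiseIdx nb nr) ℝ) =>
      hatPhi N nb (secondForcing G P Γ a.1 a.2) := by
  refine continuous_pi fun b => ?_
  have h : Continuous fun a : (Fin N → ℝ) × (Fin N → Matrix (Fin nb) (NoiseIdx nb nr) ℝ) =>
      secondForcing G P Γ a.1 a.2 b.1 := by
    unfold secondForcing
    fun_prop
  exact (continuous_apply b.2.1).comp ((continuous_apply b.2.2).comp h)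

theorem secondForcing_vecMulVec (Γ : Matrix (NoiseIdx nb nr) (NoiseIdx nb nr) ℝ) (p : Fin N → ℝ)
    (q : Fin N → Fin nb → ℝ) (γ : NoiseIdx nb nr → ℝ) :
    secondForcing G P Γ p (fun j => Matrix.vecMulVec (q j) γ) = Rmat G P p γ Γ q := by
  ext1 i
  simp [secondForcing, Rmat, Matrix.transpose_vecMulVec]

/-- Once the correlations of response and noise converge, the second moments obey an affine
recursion with matrix `calD` and convergent forcing. -/
theorem tendsto_crossCorr_noise (h : IsMarkovFor Pr P θ 𝓖)
    (hη : ∀ n, Measurable[𝓖 0] (η n)) (hη2 : ∀ n, MemLp (η n) 2 Pr)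
    (hfree : ∀ m, IsModeFree Pr θ 𝓖 η (η m)) (hD : rho (calD G P) < 1) {π : Fin N → ℝ}
    (hp : ∀ i, Tendsto (fun n => Pr.real (θ n ⁻¹' {i})) atTop (𝓝 (π i)))
    {Γ : Matrix (NoiseIdx nb nr) (NoiseIdx nb nr) ℝ} (hΓ : ∀ n, crossCorr Pr (η n) (η n) = Γ)
    {S : Fin N → Matrix (Fin nb) (NoiseIdx nb nr) ℝ}
    (hS : ∀ v, Tendsto (fun n => noiseCorr G Pr θ η (η n) v n) atTop (𝓝 fun a => S a.1 a.2 v)) :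
    Tendsto (fun n => crossCorr Pr (errorTraj G θ η 0 n) (errorTraj G θ η 0 n)) atTop
      (𝓝 (∑ i, (hatPhi N nb).symm
        ((1 - calD G P)⁻¹ *ᵥ hatPhi N nb (secondForcing G P Γ π S)) i)) := by
  set w := errorTraj G θ η 0 with hw
  set Q : ℕ → Fin N → Matrix (Fin nb) (Fin nb) ℝ := fun n i => modeCorr Pr θ n i (w n) (w n)
  have hw2 : ∀ n, MemLp (w n) 2 Pr := memLp_errorTraj G h.measurable MemLp.zero hη2
  have hrec : ∀ n, hatPhi N nb (Q (n + 1)) = calD G P *ᵥ hatPhi N nb (Q n) +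
      hatPhi N nb (secondForcing G P Γ (fun i => Pr.real (θ n ⁻¹' {i}))
        fun j => modeCorr Pr θ n j (w n) (η n)) := by
    intro n
    have hQ : Q (n + 1) = fun i => ∑ j, P j i • ((G j).Jb * Q n j * (G j).Jbᵀ) +
        secondForcing G P Γ (fun i => Pr.real (θ n ⁻¹' {i}))
          (fun j => modeCorr Pr θ n j (w n) (η n)) i := by
      ext1 i
      simp only [Q, hw, secondForcing, ← Finset.sum_add_distrib, ← smul_add]
      rw [errorTraj, h.modeCorr_jumpTraj_self (x := 0) measurable_const
        (fun n => (hη n).mono (𝓖.mono n.zero_le) le_rfl) MemLp.zero hη2]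
      refine Finset.sum_congr rfl fun j _ => ?_
      rw [(hfree n).modeCorr_eq, hΓ, Matrix.mul_smul, Matrix.smul_mul]
    rw [hQ, calD_mulVec_hatPhi]
    rfl
  have hSmat : Tendsto (fun n j => modeCorr Pr θ n j (w n) (η n)) atTop (𝓝 S) :=
    tendsto_pi_nhds.2 fun j => tendsto_pi_nhds.2 fun u => tendsto_pi_nhds.2 fun v =>
      tendsto_pi_nhds.1 (hS v) (j, u)
  have hforce := ((continuous_secondForcing (P := P) G Γ).tendsto (π, S)).comp
    ((tendsto_pi_nhds.2 hp).prodMk_nhds hSmat)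
  have hlim := tendsto_of_affine_recursion (x := fun n => hatPhi N nb (Q n)) hD hrec hforce
  refine tendsto_pi_nhds.2 fun u => tendsto_pi_nhds.2 fun v => ?_
  have hsum := tendsto_finsetSum (Finset.univ : Finset (Fin N)) fun i _ =>
    tendsto_pi_nhds.1 hlim (i, (v, u))
  rw [Matrix.sum_apply]
  refine hsum.congr fun n => ?_
  rw [← h.sum_modeCorr (hw2 n) (hw2 n) n, Matrix.sum_apply]
  rfl

theorem tendsto_meanVec_noise [IsProbabilityMeasure Pr] (h : IsMarkovFor Pr P θ 𝓖)
    (hη : ∀ n, Measurable[𝓖 0] (η n)) (hη2 : ∀ n, MemLp (η n) 2 Pr)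
    (hone : IsModeFree Pr θ 𝓖 η fun _ (_ : Unit) => (1 : ℝ)) (hC : rho (calC G P) < 1)
    {π : Fin N → ℝ} (hp : ∀ i, Tendsto (fun n => Pr.real (θ n ⁻¹' {i})) atTop (𝓝 (π i)))
    {γ : NoiseIdx nb nr → ℝ} (hγ : ∀ n, meanVec Pr (η n) = γ) :
    Tendsto (fun n => meanVec Pr (errorTraj G θ η 0 n)) atTop (𝓝 (∑ i, qLim G P π γ i)) := by
  have hlim := tendsto_noiseCorr G h hη hη2 hone hC hp (g := γ) (v := ())
    fun n s => by rw [crossCorr_one_apply, hγ]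
  refine tendsto_pi_nhds.2 fun u => ?_
  have hsum := tendsto_finsetSum (Finset.univ : Finset (Fin N)) fun i _ =>
    tendsto_pi_nhds.1 hlim (i, u)
  rw [Finset.sum_apply]
  refine hsum.congr fun n => ?_
  rw [← crossCorr_one_apply, ← h.sum_modeCorr
    (memLp_errorTraj G h.measurable MemLp.zero hη2 n) hone.memLp n, Matrix.sum_apply]
  rfl

end NoiseResponse

/-! ### Mean square convergence -/

section ErrorSystem

variable {nb nr N : ℕ} {Ω : Type*} [mΩ : MeasurableSpace Ω] {Pr : Measure Ω}
  {G : Fin N → WeightedGraph nb nr} {P : Matrix (Fin N) (Fin N) ℝ} {k₀ : ℕ} {θ : ℕ → Ω → Fin N}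
  {ε : ℕ → Ω → NoiseIdx nb nr → ℝ} {e : ℕ → Ω → Fin nb → ℝ} {x : Ω → Fin nb → ℝ}

theorem isErrorTrajectory_errorTraj (hx : IsInitialCondition Pr P θ k₀ x) :
    IsErrorTrajectory G P k₀ Pr θ ε fun k =>
      errorTraj G (fun n => θ (k₀ + n)) (fun n => ε (k₀ + n)) x (k - k₀) where
  initial := by simpa [jumpTraj] using hx
  step k hk ω := by
    rw [show k + 1 - k₀ = k - k₀ + 1 by omega]
    simp only [jumpTraj, Nat.add_sub_cancel' hk]

theorem IsErrorTrajectory.eq_errorTraj (he : IsErrorTrajectory G P k₀ Pr θ ε e) (n : ℕ) :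
    e (k₀ + n) = errorTraj G (fun n => θ (k₀ + n)) (fun n => ε (k₀ + n)) (e k₀) n := by
  induction n with
  | zero => rfl
  | succ n ih =>
    ext1 ω
    rw [← add_assoc, he.step _ (Nat.le_add_right _ _), ih]
    rfl

/-- A vector that is a function of the noise is known from the start when the whole noise sequence
is part of the information, and its correlations with the noise are independent of the modes. -/
theorem isModeFree_of_indepFun {ι : Type*} [Fintype ι] (hε : ∀ k, Measurable (ε k))
    (hθ : ∀ k, Measurable (θ k)) (hind : IndepFun (fun ω k => ε k ω) (fun ω k => θ k ω) Pr)
    {f : (ℕ → NoiseIdx nb nr → ℝ) → ι → ℝ} (hf : Measurable f)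
    (hf2 : MemLp (fun ω => f fun k => ε k ω) 2 Pr) :
    IsModeFree Pr (fun n => θ (k₀ + n))
      (pathFiltration k₀ (measurable_pi_lambda (fun ω k => ε k ω) hε) hθ)
      (fun n => ε (k₀ + n)) (fun ω => f fun k => ε k ω) where
  measurable := hf.comp (measurable_pathFiltration (measurable_pi_lambda (fun ω k => ε k ω) hε) hθ 0)
  memLp := hf2
  modeCorr_eq n j k := by
    ext s v
    have hθm : Measurable fun ω k => θ k ω := measurable_pi_lambda _ hθ
    have hεm : Measurable fun ω k => ε k ω := measurable_pi_lambda _ hε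
    have hind' := ((IndepFun_iff_Indep _ _ _).1 hind).symm
    refine Indep.setIntegral_eq_mul hθm.comap_le
      (f := fun t : ℕ → NoiseIdx nb nr → ℝ => t (k₀ + k) s * f t v) hind' hεm.aemeasurable
      ⟨(fun t => t (k₀ + n)) ⁻¹' {j}, measurable_pi_apply (k₀ + n) (MeasurableSet.singleton j), rfl⟩ ?_
    refine (Measurable.mul ?_ ?_).aestronglyMeasurable
    · fun_prop
    · exact (measurable_pi_apply v).comp hf

variable [IsProbabilityMeasure Pr]

/-- The constant initial conditions `1`, `-1` and `0` suffice: they reveal that the homogeneous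
response to the positive vector `1` tends to zero in mean square. -/
theorem MeanSquareConvergent.rho_calD_lt_one (hP : IsErgodicTransition P)
    (hθ : IsMarkovChain Pr P θ) (hε : ∀ k, MemLp (ε k) 2 Pr)
    (h : MeanSquareConvergent G P k₀ Pr θ ε) : rho (calD G P) < 1 := by
  obtain ⟨μ, Q, h⟩ := h
  set θ' : ℕ → Ω → Fin N := fun n => θ (k₀ + n)
  set η : ℕ → Ω → NoiseIdx nb nr → ℝ := fun n => ε (k₀ + n)
  have hinit := fun v : Fin nb → ℝ => hθ.isInitialCondition_const k₀ v
  have hM := (hinit 1).isMarkovFor hP.2.nonneg hθ.measurable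
  have hlim : ∀ v : Fin nb → ℝ, Tendsto (fun n => crossCorr Pr (errorTraj G θ' η (fun _ => v) n)
      (errorTraj G θ' η (fun _ => v) n)) atTop (𝓝 Q) := fun v => by
    have := (tendsto_add_atTop_iff_nat k₀).2 (h _ (isErrorTrajectory_errorTraj (hinit v))).2
    simpa only [Nat.add_sub_cancel] using this
  have hθm : ∀ n, Measurable (θ' n) := fun n => hθ.measurable _
  have hz := memLp_errorTraj G (Pr := Pr) (η := 0) hθm (memLp_const (1 : Fin nb → ℝ))
    fun _ => MemLp.zero
  have hw := memLp_errorTraj G (Pr := Pr) (η := η) hθm (memLp_const 0) fun n => hε _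
  refine rho_calD_lt_one_of_tendsto G hM hP (x := fun _ => 1)
    (measurable_const) (memLp_const 1) (fun _ _ => one_pos) ?_
  -- the parallelogram identity for the responses to `1` and `-1` isolates the homogeneous part
  have hpar := (((hlim 1).add (hlim (-1))).const_smul (2⁻¹ : ℝ)).sub (hlim 0)
  have hQ : (2⁻¹ : ℝ) • (Q + Q) - Q = 0 := by
    rw [← two_smul ℝ Q, smul_smul]
    norm_num
  rw [hQ] at hpar
  refine hpar.congr fun n => ?_
  have h1 : errorTraj G θ' η (fun _ => 1) n = fun ω =>
      errorTraj G θ' 0 (fun _ => 1) n ω + errorTraj G θ' η (fun _ => 0) n ω :=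
    funext fun ω => jumpTraj_eq_add n ω
  have h2 : errorTraj G θ' η (fun _ => -1) n = fun ω =>
      -errorTraj G θ' 0 (fun _ => 1) n ω + errorTraj G θ' η (fun _ => 0) n ω :=
    funext fun ω => (jumpTraj_eq_add n ω).trans (by rw [jumpTraj_zero_neg]; rfl)
  rw [h1, h2, crossCorr_parallelogram (hz n) (hw n), smul_smul, inv_mul_cancel₀ two_ne_zero, one_smul,
    add_sub_cancel_right]

end ErrorSystem

theorem lemma2 {nb nr N : ℕ} (G : Fin N → WeightedGraph nb nr)
    (P : Matrix (Fin N) (Fin N) ℝ) (hP : IsErgodicTransition P) (k₀ : ℕ)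
    {Ω : Type*} [MeasurableSpace Ω] (Pr : Measure Ω) [IsProbabilityMeasure Pr]
    (θ : ℕ → Ω → Fin N) (hθ : IsMarkovChain Pr P θ)
    (ε : ℕ → Ω → NoiseIdx nb nr → ℝ)
    (γ : NoiseIdx nb nr → ℝ) (Γ : Matrix (NoiseIdx nb nr) (NoiseIdx nb nr) ℝ)
    (hε : IsWideSenseStationary Pr ε γ Γ)
    (hindep : IndepFun (fun ω k => ε k ω) (fun ω k => θ k ω) Pr) :
    (MeanSquareConvergent G P k₀ Pr θ ε ↔ rho (calD G P) < 1) ∧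
    (∃! π : Fin N → ℝ, IsStationaryDistribution P π) ∧
    (MeanSquareConvergent G P k₀ Pr θ ε →
      IsUnit (1 - calC G P) ∧ IsUnit (1 - calD G P) ∧
      ∀ π : Fin N → ℝ, IsStationaryDistribution P π →
        (∀ e, IsErrorTrajectory G P k₀ Pr θ ε e →
          Tendsto (fun k => meanVec Pr (e k)) atTop (𝓝 (∑ i, qLim G P π γ i))) ∧
        (IsWhite Pr ε γ →
          (∀ e, IsErrorTrajectory G P k₀ Pr θ ε e →
            Tendsto (fun k => crossCorr Pr (e k) (e k)) atTop (𝓝 (∑ i, QLim G P π γ Γ i))) ∧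
          (∑ i, QLim G P π γ Γ i).PosSemidef)) := by
  have hP0 := hP.2.nonneg
  set θ' : ℕ → Ω → Fin N := fun n => θ (k₀ + n) with hθ'
  set η : ℕ → Ω → NoiseIdx nb nr → ℝ := fun n => ε (k₀ + n) with hη'
  have hη2 : ∀ n, MemLp (η n) 2 Pr := fun n => hε.memLp _
  have hθm : ∀ n, Measurable (θ' n) := fun n => hθ.measurable _
  -- a sample point supplies a mode
  have hN : 0 < N := by
    obtain ⟨ω⟩ := Pr.nonempty_of_neZero
    exact (Nat.zero_le _).trans_lt (θ 0 ω).2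
  have hex := existsUnique_isStationaryDistribution hP hN
  have hεm : Measurable fun ω k => ε k ω := measurable_pi_lambda _ hε.measurable
  have hM := hθ.isMarkovFor_of_indepFun hP0 k₀ hεm hindep
  have hηm : ∀ n, Measurable[pathFiltration k₀ hεm hθ.measurable 0] (η n) := fun n =>
    (measurable_pi_apply (k₀ + n)).comp (measurable_pathFiltration hεm hθ.measurable 0)
  have hfree : ∀ m, IsModeFree Pr θ' (pathFiltration k₀ hεm hθ.measurable) η (η m) := fun m =>
    isModeFree_of_indepFun hε.measurable hθ.measurable hindep (measurable_pi_apply (k₀ + m))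
      (hε.memLp _)
  have hone : IsModeFree Pr θ' (pathFiltration k₀ hεm hθ.measurable) η
      fun _ (_ : Unit) => (1 : ℝ) :=
    isModeFree_of_indepFun hε.measurable hθ.measurable hindep
      (f := fun _ _ => 1) measurable_const (memLp_const _)
  have hw2 := memLp_errorTraj G (Pr := Pr) (η := η) hθm MemLp.zero hη2
  have hmean : ∀ n, meanVec Pr (η n) = γ := fun n => hε.mean_eq _
  have hcorr : ∀ n, crossCorr Pr (η n) (η n) = Γ := fun n => hε.corr_eq _
  have hshift : ∀ k l m, crossCorr Pr (η (k + m)) (η (l + m)) = crossCorr Pr (η k) (η l) :=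
    fun k l m => by simpa only [hη', add_assoc] using hε.shift (k₀ + k) (k₀ + l) m
  -- every trajectory is the noise response plus a homogeneous part that dies out in mean square
  have hsplit : ∀ e, IsErrorTrajectory G P k₀ Pr θ ε e → ∀ n, e (n + k₀) = fun ω =>
      errorTraj G θ' 0 (e k₀) n ω + errorTraj G θ' η 0 n ω := fun e he n => by
    rw [add_comm, he.eq_errorTraj]
    ext1 ω
    exact jumpTraj_eq_add n ω
  have hz2 : ∀ e, IsErrorTrajectory G P k₀ Pr θ ε e → ∀ n,
      MemLp (errorTraj G θ' 0 (e k₀) n) 2 Pr := fun e he =>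
    memLp_errorTraj G hθm he.initial.memLp fun _ => MemLp.zero
  have hz : rho (calD G P) < 1 → ∀ e, IsErrorTrajectory G P k₀ Pr θ ε e →
      Tendsto (fun n => crossCorr Pr (errorTraj G θ' 0 (e k₀) n) (errorTraj G θ' 0 (e k₀) n))
        atTop (𝓝 0) := fun hD e he =>
    tendsto_crossCorr_homogeneous G (he.initial.isMarkovFor hP0 hθ.measurable)
      (measurable_pathFiltration he.initial.measurable hθ.measurable 0) he.initial.memLp hD
  have hQ : rho (calD G P) < 1 → ∀ Q, Tendsto (fun n => crossCorr Pr (errorTraj G θ' η 0 n)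
      (errorTraj G θ' η 0 n)) atTop (𝓝 Q) → ∀ e, IsErrorTrajectory G P k₀ Pr θ ε e →
      Tendsto (fun k => crossCorr Pr (e k) (e k)) atTop (𝓝 Q) := fun hD Q hwQ e he => by
    refine (tendsto_add_atTop_iff_nat k₀).1 ?_
    simp only [hsplit e he]
    exact tendsto_crossCorr_add_of_tendsto_zero (hz2 e he) hw2 (hz hD e he) hwQ
  have hμ : rho (calD G P) < 1 → ∀ π, IsStationaryDistribution P π →
      ∀ e, IsErrorTrajectory G P k₀ Pr θ ε e →
      Tendsto (fun k => meanVec Pr (e k)) atTop (𝓝 (∑ i, qLim G P π γ i)) :=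
    fun hD π hπ e he => by
    refine (tendsto_add_atTop_iff_nat k₀).1 ?_
    simp only [hsplit e he, meanVec_add (hz2 e he _) (hw2 _)]
    have h := (tendsto_meanVec_of_tendsto_crossCorr_zero (hz2 e he) (hz hD e he)).add
      (tendsto_meanVec_noise G hM hηm hη2 hone (rho_calC_lt_one G hP.1 hD)
        (hM.tendsto_real_preimage hP hπ) hmean)
    rwa [zero_add] at h
  have hiff : MeanSquareConvergent G P k₀ Pr θ ε ↔ rho (calD G P) < 1 := by
    refine ⟨fun h => h.rho_calD_lt_one hP hθ hε.memLp, fun hD => ?_⟩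
    obtain ⟨π, hπ, -⟩ := hex
    have hp := hM.tendsto_real_preimage hP hπ
    choose S hS using exists_tendsto_noiseCorr G hM hηm hη2 hfree (rho_calC_lt_one G hP.1 hD) hp
      hcorr hshift
    have hwQ := tendsto_crossCorr_noise G hM hηm hη2 hfree hD hp hcorr
      (S := fun j => Matrix.of fun u v => S v (j, u)) hS
    exact ⟨_, _, fun e he => ⟨hμ hD π hπ e he, hQ hD _ hwQ e he⟩⟩
  refine ⟨hiff, hex, fun hmsc => ?_⟩
  have hD := hiff.1 hmsc
  have hC := rho_calC_lt_one G hP.1 hD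
  refine ⟨isUnit_one_sub_of_rho_lt_one hC, isUnit_one_sub_of_rho_lt_one hD, fun π hπ =>
    ⟨hμ hD π hπ, fun hwhite => ?_⟩⟩
  have hp := hM.tendsto_real_preimage hP hπ
  have hwhite' : IsWhite Pr η γ := fun k l hkl => hwhite _ _ (by omega)
  have hwQ := tendsto_crossCorr_noise G hM hηm hη2 hfree hD hp hcorr
    (S := fun j => Matrix.vecMulVec (qLim G P π γ j) γ) fun v => by
      have h := (tendsto_noiseCorr G hM hηm hη2 hone hC hp (g := γ) (v := ())
        fun n s => by rw [crossCorr_one_apply, hmean]).const_smul (γ v)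
      have hval : γ v • ((1 - calC G P)⁻¹ *ᵥ psi G P π γ) =
          fun a => Matrix.vecMulVec (qLim G P π γ a.1) γ a.2 v := by
        ext a
        exact mul_comm _ _
      rw [hval] at h
      exact h.congr fun n => (noiseCorr_eq_smul_of_isWhite G hM hηm hη2 hfree hone hmean hwhite'
        n v n le_rfl).symm
  rw [secondForcing_vecMulVec] at hwQ
  have hpsd : ∀ n, (crossCorr Pr (errorTraj G θ' η 0 n) (errorTraj G θ' η 0 n)).PosSemidef :=
    fun n => crossCorr_posSemidef (hw2 n)
  refine ⟨hQ hD _ hwQ, .of_dotProduct_mulVec_nonneg ?_ fun w => ?_⟩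
  · ext u v
    have h1 := tendsto_pi_nhds.1 (tendsto_pi_nhds.1 hwQ u) v
    have h2 := tendsto_pi_nhds.1 (tendsto_pi_nhds.1 hwQ v) u
    refine tendsto_nhds_unique h2 (h1.congr fun n => ?_)
    exact congrFun (congrFun (crossCorr_transpose (μ := Pr)) v) u
  · have hcont : Continuous fun A : Matrix (Fin nb) (Fin nb) ℝ => star w ⬝ᵥ A *ᵥ w := by fun_prop
    exact ge_of_tendsto' ((hcont.tendsto _).comp hwQ) fun n => (hpsd n).dotProduct_mulVec_nonneg w
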